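/- For every $n\ge 1$ let $N=N(n)$ be a positive integer, with $0<\liminf_n N/n\le\limsup_n N/n<\infty$. Let $\|\cdot\|$ denote the Euclidean norm of vectors and the spectral norm of matrices, and let $$\Sigma_n=\frac{1}{\sqrt n}\,D_n^{1/2}X_n\tilde D_n^{1/2}+A_n ,\qquad Q_n(z)=\left(\Sigma_n\Sigma_n^*-zI_N\right)^{-1},$$ where: * $X_n=(X^n_{ij})$ is an $N\times n$ random matrix whose entries are complex, independent and identically distributed, with $\mathbb E X^n_{ij}=0$ and $\mathbb E|X^n_{ij}|^2=1$; * $A_n$ is a deterministic complex $N\times n$ matrix with $\|A_n\|\le a_{\max}$ for all $n\ge 1$; * $D_n$ ($N\times N$) and $\tilde D_n$ ($n\times n$) are deterministic real diagonal matrices with non-negative diagonal entries, and, for all $n\ge1$, $\|D_n\|\le d_{\max}$, $\|\tilde D_n\|\le\tilde d_{\max}$, $\frac1N\mathrm{Tr}\,D_n\ge d_{\min}>0$ and $\frac1n\mathrm{Tr}\,\tilde D_n\ge\tilde d_{\min}>0$. Let $p\ge1$ be an integer such that $\mathbb E|X^n_{ij}|^{8p}\le M<\infty$ for all $n,i,j$,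 and let $0<\ell^-\le\ell^+<\infty$. Write $\mathbb R^+=[0,\infty)$ and $\boldsymbol\delta_z=\mathrm{dist}(z,\mathbb R^+)$. Then there exist polynomials $\Phi_p$, $\Psi_p$ with real non-negative coefficients, depending only on $p$, $d_{\min}$, $\tilde d_{\min}$, $d_{\max}$, $\tilde d_{\max}$, $a_{\max}$, $\ell^-$, $\ell^+$ and $M$, such that for every $n\ge 1$ with $\ell^-\le N/n\le\ell^+$, every $z\in\mathbb C\setminus\mathbb R^+$ and all deterministic vectors $u_n,v_n\in\mathbb C^N$, $$\mathbb E\left|u_n^*\left(Q_n(z)-\mathbb E Q_n(z)\right)v_n\right|^{2p}\le\frac1{n^p}\,\Phi_p(|z|)\,\Psi_p\!\left(\frac1{\boldsymbol\delta_z}\right)\|u_n\|^{2p}\|v_n\|^{2p},$$ where the expectations on the left-hand side exist and are finite. (The estimate thus holds for all $n\ge1$ if $\ell^-\le N/n\le\ell^+$ for all $n\ge1$, and for all sufficiently large $n$ as soon as $\ell^-<\liminf_n N/n$ and $\limsup_n N/n<\ell^+$.) -/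

import Mathlib

open MeasureTheory ProbabilityTheory Filter Matrix Polynomial
open scoped ENNReal

noncomputable section

namespace BilinearResolvent

open scoped Matrix.Norms.L2Operator in
/-- The spectral norm of a rectangular complex matrix (operator norm for the Euclidean norms). -/
def specNorm {k l : ℕ} (M : Matrix (Fin k) (Fin l) ℂ) : ℝ := ‖M‖

/-- The closed half-line `ℝ⁺ = [0, ∞)` as a subset of `ℂ`. -/
def nonnegReals : Set ℂ := Complex.ofReal '' Set.Ici (0 : ℝ)

/-- The distance `δ_z` from `z` to `ℝ⁺`. -/
def distNonneg (z : ℂ) : ℝ := Metric.infDist z nonnegReals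

/-- The diagonal matrix with the given real diagonal, as a complex matrix. -/
def cdiag {k : ℕ} (d : Fin k → ℝ) : Matrix (Fin k) (Fin k) ℂ :=
  Matrix.diagonal fun i => (d i : ℂ)

/-- The data of the model, a sequence indexed by `n ≥ 1` (the index `0` is never used):
the dimension `N = N n`, the diagonals of `D_n` and `D̃_n`, the deterministic matrix `A_n`
and the random matrix `X_n`. -/
structure Model (Ω : Type*) where
  N : ℕ → ℕ
  d : (n : ℕ) → Fin (N n) → ℝ
  dt : (n : ℕ) → Fin n → ℝ
  A : (n : ℕ) → Matrix (Fin (N n)) (Fin n) ℂ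
  X : (n : ℕ) → Ω → Matrix (Fin (N n)) (Fin n) ℂ

namespace Model

variable {Ω : Type*} (S : Model Ω)

/-- `Σ_n = n^{-1/2} D_n^{1/2} X_n D̃_n^{1/2} + A_n`. -/
def Sig (n : ℕ) (ω : Ω) : Matrix (Fin (S.N n)) (Fin n) ℂ :=
  ((Real.sqrt n : ℝ) : ℂ)⁻¹ •
      (cdiag (fun i => Real.sqrt (S.d n i)) * S.X n ω * cdiag (fun j => Real.sqrt (S.dt n j)))
    + S.A n

/-- The resolvent `Q_n(z) = (Σ_n Σ_n^* - z I)⁻¹`. -/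
def Q (n : ℕ) (z : ℂ) (ω : Ω) : Matrix (Fin (S.N n)) (Fin (S.N n)) ℂ :=
  (S.Sig n ω * (S.Sig n ω)ᴴ - z • (1 : Matrix (Fin (S.N n)) (Fin (S.N n)) ℂ))⁻¹

/-- The entrywise expectation `E Q_n(z)`. -/
def EQ [MeasurableSpace Ω] (μ : Measure Ω) (n : ℕ) (z : ℂ) :
    Matrix (Fin (S.N n)) (Fin (S.N n)) ℂ :=
  Matrix.of fun i j => ∫ ω, S.Q n z ω i j ∂μ

end Model

/-- The sesquilinear form `u^* M v`. -/
def form {k : ℕ} (u : EuclideanSpace ℂ (Fin k)) (M : Matrix (Fin k) (Fin k) ℂ)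
    (v : EuclideanSpace ℂ (Fin k)) : ℂ :=
  star (WithLp.ofLp u) ⬝ᵥ (M *ᵥ WithLp.ofLp v)

/-- The numbers on which nice constants may depend: bounds `d_min, d̃_min, d_max, d̃_max, a_max`
for the deterministic matrices, bounds `ℓ⁻, ℓ⁺` for the ratio `N / n`, and a bound for the
moments of the entries. -/
structure Bounds where
  dmin : ℝ
  dtmin : ℝ
  dmax : ℝ
  dtmax : ℝ
  amax : ℝ
  ellMinus : ℝ
  ellPlus : ℝ
  moment : ℝ
  dmin_pos : 0 < dmin
  dtmin_pos : 0 < dtmin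
  ellMinus_pos : 0 < ellMinus

/-- The standing assumptions. Independence and identity of laws are only required of the entries
of each single matrix `X_n`. -/
structure Model.Setting {Ω : Type*} [MeasurableSpace Ω] (S : Model Ω) (μ : Measure Ω)
    (p : ℕ) (c : Bounds) : Prop where
  liminf_pos : 0 < liminf (fun n : ℕ => (S.N n : ℝ≥0∞) / (n : ℝ≥0∞)) atTop
  limsup_lt_top : limsup (fun n : ℕ => (S.N n : ℝ≥0∞) / (n : ℝ≥0∞)) atTop < ∞
  measurable_X : ∀ n, 1 ≤ n → ∀ i j, Measurable fun ω => S.X n ω i j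
  indep_X : ∀ n, 1 ≤ n → iIndepFun (fun (ij : Fin (S.N n) × Fin n) ω => S.X n ω ij.1 ij.2) μ
  ident_X : ∀ n, 1 ≤ n → ∀ i j i' j',
    IdentDistrib (fun ω => S.X n ω i j) (fun ω => S.X n ω i' j') μ μ
  mean_X : ∀ n, 1 ≤ n → ∀ i j, ∫ ω, S.X n ω i j ∂μ = 0
  variance_X : ∀ n, 1 ≤ n → ∀ i j, ∫ ω, ‖S.X n ω i j‖ ^ 2 ∂μ = 1
  integrable_moment_X : ∀ n, 1 ≤ n → ∀ i j, Integrable (fun ω => ‖S.X n ω i j‖ ^ (8 * p)) μ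
  moment_X_le : ∀ n, 1 ≤ n → ∀ i j, ∫ ω, ‖S.X n ω i j‖ ^ (8 * p) ∂μ ≤ c.moment
  A_le : ∀ n, 1 ≤ n → specNorm (S.A n) ≤ c.amax
  d_nonneg : ∀ n, 1 ≤ n → ∀ i, 0 ≤ S.d n i
  dt_nonneg : ∀ n, 1 ≤ n → ∀ j, 0 ≤ S.dt n j
  D_le : ∀ n, 1 ≤ n → specNorm (cdiag (S.d n)) ≤ c.dmax
  Dt_le : ∀ n, 1 ≤ n → specNorm (cdiag (S.dt n)) ≤ c.dtmax
  le_trace_D : ∀ n, 1 ≤ n → c.dmin ≤ (∑ i, S.d n i) / (S.N n : ℝ)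
  le_trace_Dt : ∀ n, 1 ≤ n → c.dtmin ≤ (∑ j, S.dt n j) / (n : ℝ)

end BilinearResolvent

end

/-! The resolvent is the first block of the inverse `G` of the linearization with blocks `-z`, `Σ`,
`Σᴴ`, `-1`. The norm of `G` is at most `3 (1 + |z|)(1 + 1/δ_z)`, and each entry of `X` occurs in two
symmetric positions only. Setting the entry `(i, j)` to zero moves `f = u* Q v`, to first order, by
`n^{-1/2}` times the entry times products of the components at row `i` and column `j` of the left
vector `U G` and the right vector `G V`. The squares of these products, summed over `(i, j)`, are
bounded by the squared norms of the two vectors, so the total is `τ = O(1/n)`.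

With `m = E f`, moments follow by induction on `q` from `E|f-m|^{2q} = Var|f-m|^q + (E|f-m|^q)^2`.
Cauchy–Schwarz splits the last term into moments of orders `2⌊q/2⌋` and `2⌈q/2⌉`. The variance is
bounded by `efron_stein`, with increments controlled at the point where the coordinate is zero; this
control is independent of the entry, whose moment factors out.

These zeroed points vary with the coordinate, whereas the sum of the weights is bounded at a single
point. By `LocalControl.weight_le_integral`, the weight at the zeroed point is at most a constant
times its average over a resampled coordinate: the entry has modulus at most 2 with probability at
least 1/2, and there the two weights are comparable. Resampling preserves the product law, so the
sum moves under one integral and gives `τ (E|f-m|^{2q-2} + τ^{q-1})`. `exists_moment_bound` closes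
the induction; `norm_le_kap_mul` and `localControl_linInv` supply its hypotheses. -/

namespace BilinearResolvent

/-! ### Resampling one coordinate of a product measure. -/

section Resampling

variable {ι α : Type*} [DecidableEq ι] [MeasurableSpace α]

theorem measurable_update_prod (k : ι) :
    Measurable fun q : (ι → α) × α => Function.update q.1 k q.2 := by
  refine measurable_pi_lambda _ fun j => ?_
  by_cases h : j = k
  · subst h; simpa using measurable_snd
  · simp only [Function.update_of_ne h]
    exact (measurable_pi_apply j).comp measurable_fst

theorem measurable_update_const (k : ι) (a : α) :
    Measurable fun x : ι → α => Function.update x k a :=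
  (measurable_update_prod k).comp (measurable_id.prodMk measurable_const)

/-- Resampling one coordinate of a product measure does not change the law. -/
theorem measurePreserving_update [Fintype ι] (ν : ι → Measure α)
    [∀ i, IsProbabilityMeasure (ν i)] (k : ι) :
    MeasurePreserving (fun q : (ι → α) × α => Function.update q.1 k q.2)
      ((Measure.pi ν).prod (ν k)) (Measure.pi ν) := by
  refine ⟨measurable_update_prod k, (Measure.pi_eq fun s hs => ?_).symm⟩
  rw [Measure.map_apply (measurable_update_prod k) (MeasurableSet.univ_pi hs)]
  -- The old coordinate `k` is discarded, so its factor is the whole space, of mass one; the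
  -- constraint `s k` falls on the fresh coordinate.
  have h : (fun q : (ι → α) × α => Function.update q.1 k q.2) ⁻¹' (Set.univ.pi s)
      = (Set.univ.pi (Function.update s k Set.univ)) ×ˢ (s k) := by
    ext q
    simp only [Set.mem_preimage, Set.mem_univ_pi, Set.mem_prod]
    constructor
    · intro h
      refine ⟨fun j => ?_, by simpa using h k⟩
      by_cases hj : j = k
      · subst hj; simp
      · simpa [Function.update_of_ne hj] using h j
    · rintro ⟨h1, h2⟩ j
      by_cases hj : j = k
      · subst hj; simpa using h2
      · simpa [Function.update_of_ne hj] using h1 j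
  rw [h, Measure.prod_prod, Measure.pi_pi, ← Finset.mul_prod_erase _ _ (Finset.mem_univ k),
    ← Finset.mul_prod_erase _ (fun i => (ν i) (s i)) (Finset.mem_univ k)]
  simp only [Function.update_self, measure_univ, one_mul]
  rw [mul_comm]
  congr 1
  refine Finset.prod_congr rfl fun j hj => ?_
  rw [Function.update_of_ne (Finset.ne_of_mem_erase hj)]

variable [Fintype ι] (ν : ι → Measure α) [∀ i, IsProbabilityMeasure (ν i)]

theorem integrable_update {g : (ι → α) → ℝ} (hg : Integrable g (Measure.pi ν)) (k : ι) :
    Integrable (fun q : (ι → α) × α => g (Function.update q.1 k q.2))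
      ((Measure.pi ν).prod (ν k)) :=
  (measurePreserving_update ν k).integrable_comp_of_integrable hg

theorem integral_update {g : (ι → α) → ℝ} (hg : Integrable g (Measure.pi ν)) (k : ι) :
    ∫ x, ∫ y, g (Function.update x k y) ∂(ν k) ∂(Measure.pi ν) = ∫ x, g x ∂(Measure.pi ν) := by
  rw [integral_integral (f := fun x y => g (Function.update x k y)) (integrable_update ν hg k)]
  have h := measurePreserving_update ν k
  conv_rhs => rw [← h.map_eq]
  rw [integral_map h.measurable.aemeasurable]
  rw [h.map_eq]; exact hg.aestronglyMeasurable

theorem integrable_of_bound {β E : Type*} [MeasurableSpace β] [NormedAddCommGroup E]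
    [MeasurableSpace E] [BorelSpace E] [SecondCountableTopology E]
    {ρ : Measure β} [IsFiniteMeasure ρ] {f : β → E}
    (hf : Measurable f) (b : ℝ) (hb : ∀ x, ‖f x‖ ≤ b) : Integrable f ρ :=
  Integrable.of_bound hf.aestronglyMeasurable b (Eventually.of_forall hb)

end Resampling

/-! ### Bias–variance identities and the Efron–Stein inequality. -/

section EfronStein

theorem integral_norm_sub_sq {β : Type*} [MeasurableSpace β] {ρ : Measure β}
    [IsProbabilityMeasure ρ] {W : β → ℂ} (hW : Measurable W) {b : ℝ} (hb : ∀ x, ‖W x‖ ≤ b)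
    (a : ℂ) :
    ∫ x, ‖W x - a‖ ^ 2 ∂ρ = ∫ x, ‖W x - ∫ y, W y ∂ρ‖ ^ 2 ∂ρ + ‖(∫ y, W y ∂ρ) - a‖ ^ 2 := by
  set m := ∫ y, W y ∂ρ with hm
  have hWi : Integrable W ρ := integrable_of_bound hW b hb
  have hci : Integrable (fun x => W x - m) ρ := hWi.sub (integrable_const _)
  have hsq : Integrable (fun x => ‖W x - m‖ ^ 2) ρ := by
    refine integrable_of_bound ((hW.sub measurable_const).norm.pow_const 2) ((b + ‖m‖) ^ 2)
      fun x => ?_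
    rw [norm_pow, norm_norm]
    gcongr
    exact (norm_sub_le _ _).trans (by gcongr; exact hb x)
  have h0 : ∫ x, inner ℝ (m - a) (W x - m) ∂ρ = 0 := by
    rw [integral_inner hci, integral_sub hWi (integrable_const _)]
    simp [← hm]
  have hin : Integrable (fun x => inner ℝ (m - a) (W x - m)) ρ := hci.const_inner _
  have hpt : ∀ x, ‖W x - a‖ ^ 2
      = ‖W x - m‖ ^ 2 + 2 * inner ℝ (m - a) (W x - m) + ‖m - a‖ ^ 2 := by
    intro x
    have h := norm_add_sq_real (W x - m) (m - a)
    rw [sub_add_sub_cancel, real_inner_comm] at h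
    exact h
  simp_rw [hpt]
  have hadd : Integrable (fun x => ‖W x - m‖ ^ 2 + 2 * inner ℝ (m - a) (W x - m)) ρ :=
    hsq.add (hin.const_mul 2)
  rw [integral_add hadd (integrable_const _), integral_add hsq (hin.const_mul 2),
    integral_const_mul, h0]
  simp

theorem norm_integral_sq_le {β : Type*} [MeasurableSpace β] {ρ : Measure β}
    [IsProbabilityMeasure ρ] {W : β → ℂ} (hW : Measurable W) {b : ℝ} (hb : ∀ x, ‖W x‖ ≤ b) :
    ‖∫ y, W y ∂ρ‖ ^ 2 ≤ ∫ x, ‖W x‖ ^ 2 ∂ρ := by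
  have h := integral_norm_sub_sq (ρ := ρ) hW hb 0
  simp only [sub_zero] at h
  have : 0 ≤ ∫ x, ‖W x - ∫ y, W y ∂ρ‖ ^ 2 ∂ρ := integral_nonneg fun _ => by positivity
  linarith

/-- Bias–variance on both sides: the variance of `Y` is at most its mean square about `a`, and the
squared bias `|E Y - E g|²` is at most `E|Y - g|²` by Jensen. -/
theorem integral_norm_sub_integral_sq_le {β : Type*} [MeasurableSpace β] {ρ : Measure β}
    [IsProbabilityMeasure ρ] {Y g : β → ℂ} (hY : Measurable Y) (hg : Measurable g) {b b' : ℝ}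
    (hb : ∀ x, ‖Y x‖ ≤ b) (hb' : ∀ x, ‖g x‖ ≤ b') (a : ℂ) :
    ∫ x, ‖Y x - ∫ y, g y ∂ρ‖ ^ 2 ∂ρ
      ≤ ∫ x, ‖Y x - a‖ ^ 2 ∂ρ + ∫ x, ‖Y x - g x‖ ^ 2 ∂ρ := by
  rw [integral_norm_sub_sq hY hb (∫ y, g y ∂ρ), integral_norm_sub_sq hY hb a,
    ← integral_sub (integrable_of_bound hY b hb) (integrable_of_bound hg b' hb')]
  have h := norm_integral_sq_le (ρ := ρ) (hY.sub hg) (b := b + b')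
    (fun x => (norm_sub_le _ _).trans (add_le_add (hb x) (hb' x)))
  simp only [Pi.sub_apply] at h
  have : 0 ≤ ‖(∫ y, Y y ∂ρ) - a‖ ^ 2 := by positivity
  linarith

variable {ι α : Type*} [Fintype ι] [DecidableEq ι] [MeasurableSpace α]

/-- Coordinates are averaged out one at a time, each costing at most its own increment. No
martingale differences or conditional expectations are needed. -/
theorem exists_partial_average (ν : ι → Measure α) [∀ i, IsProbabilityMeasure (ν i)] (a : α)
    {Y : (ι → α) → ℂ} (hY : Measurable Y) {b : ℝ} (hb : ∀ x, ‖Y x‖ ≤ b) (s : Finset ι) :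
    ∃ g : (ι → α) → ℂ, Measurable g ∧ (∀ x, ‖g x‖ ≤ b) ∧
      (∀ k ∈ s, ∀ x y, g (Function.update x k y) = g x) ∧
      ∫ x, ‖Y x - g x‖ ^ 2 ∂(Measure.pi ν)
        ≤ ∑ k ∈ s, ∫ x, ‖Y x - Y (Function.update x k a)‖ ^ 2 ∂(Measure.pi ν) := by
  have hsqi : ∀ {g : (ι → α) → ℂ}, Measurable g → (∀ x, ‖g x‖ ≤ b) →
      Integrable (fun x => ‖Y x - g x‖ ^ 2) (Measure.pi ν) := by
    intro g hg hgb
    refine integrable_of_bound ((hY.sub hg).norm.pow_const 2) ((b + b) ^ 2) fun x => ?_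
    rw [norm_pow, norm_norm]
    gcongr
    exact (norm_sub_le _ _).trans (add_le_add (hb x) (hgb x))
  induction s using Finset.induction_on with
  | empty => exact ⟨Y, hY, hb, by simp, by simp⟩
  | insert k s hk ih =>
    obtain ⟨g, hg, hgb, hgs, hle⟩ := ih
    have hg' : Measurable fun x => ∫ y, g (Function.update x k y) ∂(ν k) :=
      (StronglyMeasurable.integral_prod_right (f := fun x y => g (Function.update x k y))
        (hg.comp (measurable_update_prod k)).stronglyMeasurable).measurable
    have hgb' : ∀ x, ‖∫ y, g (Function.update x k y) ∂(ν k)‖ ≤ b := fun x => by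
      simpa using norm_integral_le_of_norm_le_const (μ := ν k)
        (Eventually.of_forall fun y => hgb (Function.update x k y))
    have hself : ∀ x y, ∫ y', g (Function.update (Function.update x k y) k y') ∂(ν k)
        = ∫ y', g (Function.update x k y') ∂(ν k) := fun x y => by simp
    refine ⟨fun x => ∫ y, g (Function.update x k y) ∂(ν k), hg', hgb', ?_, ?_⟩
    · intro l hl x y
      rcases Finset.mem_insert.1 hl with rfl | hl
      · exact hself x y
      · have hlk : l ≠ k := fun h => hk (h ▸ hl)
        refine integral_congr_ae (Eventually.of_forall fun y' => ?_)
        simp only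
        rw [Function.update_comm hlk, hgs l hl]
    · rw [Finset.sum_insert hk]
      refine le_trans ?_ (add_le_add_right hle _)
      have hYa : Measurable fun x => Y (Function.update x k a) :=
        hY.comp (measurable_update_const k a)
      have i1 := hsqi hg' hgb'
      have i2 := hsqi hYa fun x => hb _
      have i3 := hsqi hg hgb
      -- After resampling `k` in all three integrals and fixing the other coordinates, the value at
      -- `a` is a constant and the one-variable inequality applies.
      rw [← integral_update ν i1 k, ← integral_update ν i2 k, ← integral_update ν i3 k,
        ← integral_add (integrable_update ν i2 k).integral_prod_left
          (integrable_update ν i3 k).integral_prod_left]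
      refine integral_mono (integrable_update ν i1 k).integral_prod_left
        ((integrable_update ν i2 k).integral_prod_left.add
          (integrable_update ν i3 k).integral_prod_left) fun x => ?_
      simp only [Function.update_idem]
      have hu : Measurable fun y => Function.update x k y :=
        (measurable_update_prod k).comp (measurable_const.prodMk measurable_id)
      exact integral_norm_sub_integral_sq_le (hY.comp hu) (hg.comp hu) (fun y => hb _)
        (fun y => hgb _) _

/-- The Efron–Stein inequality, each coordinate being compared with a fixed value. -/
theorem efron_stein (ν : ι → Measure α) [∀ i, IsProbabilityMeasure (ν i)] (a : α)
    {Y : (ι → α) → ℂ} (hY : Measurable Y) {b : ℝ} (hb : ∀ x, ‖Y x‖ ≤ b) :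
    ∫ x, ‖Y x - ∫ y, Y y ∂(Measure.pi ν)‖ ^ 2 ∂(Measure.pi ν)
      ≤ ∑ k, ∫ x, ‖Y x - Y (Function.update x k a)‖ ^ 2 ∂(Measure.pi ν) := by
  obtain ⟨g, -, -, hgs, hle⟩ := exists_partial_average ν a hY hb Finset.univ
  have hconst : ∀ x, g x = g fun _ => a := by
    intro x
    have key : ∀ s : Finset ι, g (s.piecewise (fun _ => a) x) = g x := by
      intro s
      induction s using Finset.induction_on with
      | empty => simp
      | insert k s _ ih => rw [Finset.piecewise_insert, hgs k (Finset.mem_univ k), ih]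
    simpa using (key Finset.univ).symm
  simp only [hconst] at hle
  rw [integral_norm_sub_sq hY hb (g fun _ => a)] at hle
  refine le_trans ?_ hle
  have : 0 ≤ ‖(∫ y, Y y ∂(Measure.pi ν)) - g fun _ => a‖ ^ 2 := by positivity
  linarith

end EfronStein

/-! ### Higher moments from coordinatewise control. -/

section MomentBound

/-- Coordinatewise control of the function `f` of independent complex variables: the squared
increment of `f` from the point where the coordinate `k` is set to zero is at most a polynomial
in that coordinate times a weight which does not depend on it, and these weights are dominated
by functions whose sum over `k` is at most `τ`. -/
structure LocalControl {ι : Type*} [Fintype ι] [DecidableEq ι] (ν : ι → Measure ℂ) (p : ℕ)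
    (M : ℝ) (f : (ι → ℂ) → ℂ) (w h : ι → (ι → ℂ) → ℝ) (b τ : ℝ) : Prop where
  integrable_moment : ∀ k, Integrable (fun y => (1 + ‖y‖) ^ (4 * p)) (ν k)
  moment_le : ∀ k, ∫ y, (1 + ‖y‖) ^ (4 * p) ∂(ν k) ≤ M
  half_le : ∀ k, 1 / 2 ≤ (ν k).real {y | ‖y‖ ≤ 2}
  measurable_f : Measurable f
  norm_f_le : ∀ x, ‖f x‖ ≤ b
  measurable_h : ∀ k, Measurable (h k)
  h_nonneg : ∀ k x, 0 ≤ h k x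
  sum_h_le : ∀ x, ∑ k, h k x ≤ τ
  w_nonneg : ∀ k x, 0 ≤ w k x
  w_le : ∀ k x, ‖x k‖ ≤ 2 → w k (Function.update x k 0) ≤ h k x
  increment_le : ∀ k x, ‖f x - f (Function.update x k 0)‖ ^ 2
    ≤ (1 + ‖x k‖) ^ 4 * w k (Function.update x k 0)

/-- Mean value bound with `max a b ≤ b + D`. Everything is expressed through `b`, the value at the
zeroed point, so that only `P` involves the coordinate being changed. -/
theorem sq_pow_sub_pow_le {a b D P w τ : ℝ} (r : ℕ) (ha : 0 ≤ a) (hb : 0 ≤ b) (hD : 0 ≤ D)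
    (hab : |a - b| ≤ D) (hP : 1 ≤ P) (hw : 0 ≤ w) (hwτ : w ≤ τ) (hDw : D ^ 2 ≤ P * w) :
    (a ^ (r + 1) - b ^ (r + 1)) ^ 2
      ≤ ((r + 1) ^ 2 * 4 ^ r) * P ^ (r + 1) * (w * (b ^ (2 * r) + τ ^ r)) := by
  have h1 : |a ^ (r + 1) - b ^ (r + 1)| ≤ D * (r + 1) * (b + D) ^ r := by
    refine (abs_pow_sub_pow_le a b (r + 1)).trans ?_
    rw [abs_of_nonneg ha, abs_of_nonneg hb, Nat.add_sub_cancel]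
    push_cast
    have : max a b ≤ b + D := max_le (by linarith [le_abs_self (a - b)]) (by linarith)
    gcongr
  have h2 : (b + D) ^ (2 * r) ≤ 4 ^ r * (b ^ (2 * r) + D ^ (2 * r)) := by
    refine (add_pow_le hb hD (2 * r)).trans ?_
    have : (2 : ℝ) ^ (2 * r - 1) ≤ 4 ^ r := by
      rw [show (4 : ℝ) = 2 ^ 2 by norm_num, ← pow_mul]
      exact pow_le_pow_right₀ (by norm_num) (Nat.sub_le _ _)
    gcongr
  have h3 : D ^ (2 * r) ≤ P ^ r * τ ^ r := by
    rw [pow_mul, ← mul_pow]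
    exact pow_le_pow_left₀ (by positivity) (hDw.trans (by gcongr)) r
  have h4 : b ^ (2 * r) ≤ P ^ r * b ^ (2 * r) :=
    le_mul_of_one_le_left (by positivity) (one_le_pow₀ hP)
  have hτ : 0 ≤ τ := hw.trans hwτ
  calc (a ^ (r + 1) - b ^ (r + 1)) ^ 2 = |a ^ (r + 1) - b ^ (r + 1)| ^ 2 := (sq_abs _).symm
    _ ≤ (D * (r + 1) * (b + D) ^ r) ^ 2 := by gcongr
    _ = (r + 1) ^ 2 * D ^ 2 * (b + D) ^ (2 * r) := by ring
    _ ≤ (r + 1) ^ 2 * (P * w) * (4 ^ r * (P ^ r * b ^ (2 * r) + P ^ r * τ ^ r)) := by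
        gcongr
        exact h2.trans (by gcongr)
    _ = _ := by ring

/-- Cauchy–Schwarz: the quadratic `t ↦ ∫ (f t + g)²` is non-negative, so its discriminant is not
positive. -/
theorem sq_integral_mul_le {β : Type*} [MeasurableSpace β] {ρ : Measure β} {f g : β → ℝ}
    (hf : Integrable (fun x => f x ^ 2) ρ) (hg : Integrable (fun x => g x ^ 2) ρ)
    (hfg : Integrable (fun x => f x * g x) ρ) :
    (∫ x, f x * g x ∂ρ) ^ 2 ≤ (∫ x, f x ^ 2 ∂ρ) * ∫ x, g x ^ 2 ∂ρ := by
  have h : ∀ t : ℝ, 0 ≤ (∫ x, f x ^ 2 ∂ρ) * (t * t) + (2 * ∫ x, f x * g x ∂ρ) * t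
      + ∫ x, g x ^ 2 ∂ρ := by
    intro t
    have e : (∫ x, f x ^ 2 ∂ρ) * (t * t) + (2 * ∫ x, f x * g x ∂ρ) * t + ∫ x, g x ^ 2 ∂ρ
        = ∫ x, (f x * t + g x) ^ 2 ∂ρ := by
      have hpt : ∀ x, (f x * t + g x) ^ 2
          = (t * t) * f x ^ 2 + (2 * t) * (f x * g x) + g x ^ 2 := fun x => by ring
      have hadd : Integrable (fun x => (t * t) * f x ^ 2 + (2 * t) * (f x * g x)) ρ :=
        (hf.const_mul _).add (hfg.const_mul _)
      simp_rw [hpt]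
      rw [integral_add hadd hg, integral_add (hf.const_mul _) (hfg.const_mul _),
        integral_const_mul, integral_const_mul]
      ring
    rw [e]
    exact integral_nonneg fun _ => by positivity
  have hd := discrim_le_zero h
  rw [discrim] at hd
  nlinarith

variable {ι : Type*} [Fintype ι] [DecidableEq ι] {ν : ι → Measure ℂ}
  {p : ℕ} {M : ℝ} {f : (ι → ℂ) → ℂ}
  {w h : ι → (ι → ℂ) → ℝ} {b τ : ℝ}

namespace LocalControl

theorem tau_nonneg (H : LocalControl ν p M f w h b τ) : 0 ≤ τ :=
  (Finset.sum_nonneg fun k _ => H.h_nonneg k 0).trans (H.sum_h_le 0)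

theorem h_le (H : LocalControl ν p M f w h b τ) (k : ι) (x : ι → ℂ) : h k x ≤ τ :=
  (Finset.single_le_sum (fun l _ => H.h_nonneg l x) (Finset.mem_univ k)).trans (H.sum_h_le x)

theorem w_update_le (H : LocalControl ν p M f w h b τ) (k : ι) (x : ι → ℂ) : w k (Function.update x k 0) ≤ τ := by
  have := H.w_le k (Function.update x k 0) (by simp)
  rw [Function.update_idem] at this
  exact this.trans (H.h_le _ _)

variable [∀ i, IsProbabilityMeasure (ν i)]

theorem integrable_norm_pow (H : LocalControl ν p M f w h b τ) (m : ℂ) (r : ℕ) :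
    Integrable (fun x => ‖f x - m‖ ^ r) (Measure.pi ν) := by
  refine integrable_of_bound ((H.measurable_f.sub measurable_const).norm.pow_const r)
    ((b + ‖m‖) ^ r) fun x => ?_
  rw [norm_pow, norm_norm]
  gcongr
  exact (norm_sub_le _ _).trans (by gcongr; exact H.norm_f_le x)

/-- On a bounded range of the coordinate `k`, the point with that coordinate set to zero can be
replaced by the point itself. -/
theorem weight_le_integral (H : LocalControl ν p M f w h b τ) (m : ℂ) (r : ℕ) (k : ι)
    (x : ι → ℂ) :
    w k (Function.update x k 0) * (‖f (Function.update x k 0) - m‖ ^ (2 * r) + τ ^ r)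
      ≤ 2 * (324 ^ r + 1) * ∫ y, h k (Function.update x k y)
          * (‖f (Function.update x k y) - m‖ ^ (2 * r) + τ ^ r) ∂(ν k) := by
  have hτ := H.tau_nonneg
  have hu : Measurable fun y => Function.update x k y :=
    (measurable_update_prod k).comp (measurable_const.prodMk measurable_id)
  set W := w k (Function.update x k 0) with hW
  set B := ‖f (Function.update x k 0) - m‖ with hB
  set G : ℂ → ℝ := fun y => h k (Function.update x k y)
      * (‖f (Function.update x k y) - m‖ ^ (2 * r) + τ ^ r) with hG
  have hG0 : ∀ y, 0 ≤ G y := fun y => mul_nonneg (H.h_nonneg _ _) (by positivity)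
  have hGm : Measurable G := ((H.measurable_h k).comp hu).mul
    ((((H.measurable_f.comp hu).sub measurable_const).norm.pow_const _).add_const _)
  have hGi : Integrable G (ν k) := by
    refine integrable_of_bound hGm (τ * ((b + ‖m‖) ^ (2 * r) + τ ^ r)) fun y => ?_
    rw [Real.norm_of_nonneg (hG0 y)]
    refine mul_le_mul (H.h_le _ _) ?_ (by positivity) hτ
    gcongr
    exact (norm_sub_le _ _).trans (by gcongr; exact H.norm_f_le _)
  -- For `‖y‖ ≤ 2` the increment satisfies `D² ≤ (1 + 2)^4 τ = 81 τ`, and `(E + D)^{2r} ≤ 4^r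
  -- (E^{2r} + D^{2r})`; hence `324 = 4 · 81`. The further factor 2 is the inverse of the
  -- probability bound 1/2.
  have hpt : ∀ y ∈ {y : ℂ | ‖y‖ ≤ 2}, W * (B ^ (2 * r) + τ ^ r) ≤ (324 ^ r + 1) * G y := by
    intro y hy
    have hwh : W ≤ h k (Function.update x k y) := by
      simpa using H.w_le k (Function.update x k y) (by simpa using hy)
    set D := ‖f (Function.update x k y) - f (Function.update x k 0)‖ with hD
    have hD2 : D ^ 2 ≤ 81 * τ := by
      have := H.increment_le k (Function.update x k y)
      rw [Function.update_idem, Function.update_self] at this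
      refine this.trans (mul_le_mul ?_ (H.w_update_le k x) (H.w_nonneg _ _) (by norm_num))
      calc (1 + ‖y‖) ^ 4 ≤ (1 + 2) ^ 4 := by gcongr; exact hy
        _ = 81 := by norm_num
    set E := ‖f (Function.update x k y) - m‖ with hE
    have hBE : B ≤ E + D := by
      have : f (Function.update x k 0) - m = (f (Function.update x k y) - m)
        - (f (Function.update x k y) - f (Function.update x k 0)) := by ring
      rw [hB, this]
      exact norm_sub_le _ _
    have h1 : B ^ (2 * r) ≤ 4 ^ r * (E ^ (2 * r) + (81 * τ) ^ r) := by
      calc B ^ (2 * r) ≤ (E + D) ^ (2 * r) := by gcongr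
        _ ≤ 2 ^ (2 * r - 1) * (E ^ (2 * r) + D ^ (2 * r)) :=
          add_pow_le (norm_nonneg _) (norm_nonneg _) _
        _ ≤ 4 ^ r * (E ^ (2 * r) + (81 * τ) ^ r) := by
          have h2 : (2 : ℝ) ^ (2 * r - 1) ≤ 4 ^ r := by
            rw [show (4 : ℝ) = 2 ^ 2 by norm_num, ← pow_mul]
            exact pow_le_pow_right₀ (by norm_num) (Nat.sub_le _ _)
          have h3 : D ^ (2 * r) ≤ (81 * τ) ^ r := by rw [pow_mul]; gcongr
          gcongr
    have h4 : (4 : ℝ) ^ r ≤ 324 ^ r := by gcongr; norm_num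
    have h5 : (4 : ℝ) ^ r * (81 * τ) ^ r = 324 ^ r * τ ^ r := by
      rw [← mul_pow, ← mul_pow]; congr 1; ring
    have hE0 : 0 ≤ E ^ (2 * r) := by positivity
    have hτ0 : 0 ≤ τ ^ r := by positivity
    have h6 : B ^ (2 * r) + τ ^ r ≤ (324 ^ r + 1) * (E ^ (2 * r) + τ ^ r) := by
      nlinarith [mul_le_mul_of_nonneg_right h4 hE0]
    calc W * (B ^ (2 * r) + τ ^ r)
        ≤ h k (Function.update x k y) * ((324 ^ r + 1) * (E ^ (2 * r) + τ ^ r)) :=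
          mul_le_mul hwh h6 (by positivity) (H.h_nonneg _ _)
      _ = (324 ^ r + 1) * G y := by rw [hG]; ring
  have hmeas : MeasurableSet {y : ℂ | ‖y‖ ≤ 2} := measurableSet_le measurable_norm measurable_const
  have h_int : (ν k).real {y : ℂ | ‖y‖ ≤ 2} * (W * (B ^ (2 * r) + τ ^ r))
      ≤ ∫ y, (324 ^ r + 1) * G y ∂(ν k) := by
    calc (ν k).real {y : ℂ | ‖y‖ ≤ 2} * (W * (B ^ (2 * r) + τ ^ r))
        = ∫ y in {y : ℂ | ‖y‖ ≤ 2}, W * (B ^ (2 * r) + τ ^ r) ∂(ν k) := by simp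
      _ ≤ ∫ y in {y : ℂ | ‖y‖ ≤ 2}, (324 ^ r + 1) * G y ∂(ν k) :=
          setIntegral_mono_on (integrable_const _) (hGi.const_mul _).integrableOn hmeas hpt
      _ ≤ ∫ y, (324 ^ r + 1) * G y ∂(ν k) :=
          setIntegral_le_integral (hGi.const_mul _)
            (Eventually.of_forall fun y => mul_nonneg (by positivity) (hG0 y))
  rw [integral_const_mul] at h_int
  have hWB : 0 ≤ W * (B ^ (2 * r) + τ ^ r) := mul_nonneg (H.w_nonneg _ _) (by positivity)
  nlinarith [H.half_le k]

/-- Converts the Efron–Stein sum for a function `Y` of `f` into a lower moment of `f`: the moment of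
each coordinate factors out, the weight is averaged back, and the bound on `∑ h` is used inside a
single integral. -/
theorem sum_integral_increment_le (H : LocalControl ν p M f w h b τ) (m : ℂ) (r : ℕ)
    {Y : (ι → ℂ) → ℂ} (hY : Measurable Y)
    {b' C : ℝ} (hb' : ∀ x, ‖Y x‖ ≤ b') (hC : 0 ≤ C) (hM : 0 ≤ M)
    (hYle : ∀ k x, ‖Y x - Y (Function.update x k 0)‖ ^ 2 ≤ C * (1 + ‖x k‖) ^ (4 * p) *
      (w k (Function.update x k 0) * (‖f (Function.update x k 0) - m‖ ^ (2 * r) + τ ^ r))) :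
    ∑ k, ∫ x, ‖Y x - Y (Function.update x k 0)‖ ^ 2 ∂(Measure.pi ν)
      ≤ C * M * (2 * (324 ^ r + 1)) *
        (τ * ((∫ x, ‖f x - m‖ ^ (2 * r) ∂(Measure.pi ν)) + τ ^ r)) := by
  have hτ := H.tau_nonneg
  set G : ι → (ι → ℂ) → ℝ := fun k x => h k x * (‖f x - m‖ ^ (2 * r) + τ ^ r) with hG
  have hG0 : ∀ k x, 0 ≤ G k x := fun k x => mul_nonneg (H.h_nonneg _ _) (by positivity)
  have hfi : Integrable (fun x => ‖f x - m‖ ^ (2 * r) + τ ^ r) (Measure.pi ν) :=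
    (H.integrable_norm_pow m (2 * r)).add (integrable_const _)
  have hGi : ∀ k, Integrable (G k) (Measure.pi ν) := fun k =>
    hfi.bdd_mul (c := τ) (H.measurable_h k).aestronglyMeasurable
      (Eventually.of_forall fun x => by
        rw [Real.norm_of_nonneg (H.h_nonneg _ _)]; exact H.h_le k x)
  have hk : ∀ k, ∫ x, ‖Y x - Y (Function.update x k 0)‖ ^ 2 ∂(Measure.pi ν)
      ≤ C * M * (2 * (324 ^ r + 1)) * ∫ x, G k x ∂(Measure.pi ν) := by
    intro k
    have hYi : Integrable (fun x => ‖Y x - Y (Function.update x k 0)‖ ^ 2) (Measure.pi ν) := by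
      refine integrable_of_bound
        ((hY.sub (hY.comp (measurable_update_const k 0))).norm.pow_const 2) ((b' + b') ^ 2)
        fun x => ?_
      rw [norm_pow, norm_norm]
      gcongr
      exact (norm_sub_le _ _).trans (add_le_add (hb' _) (hb' _))
    rw [← integral_update ν hYi k, ← integral_update ν (hGi k) k, ← integral_const_mul]
    refine integral_mono (integrable_update ν hYi k).integral_prod_left
      ((integrable_update ν (hGi k) k).integral_prod_left.const_mul _) fun x => ?_
    simp only [Function.update_idem]
    set V := w k (Function.update x k 0)
      * (‖f (Function.update x k 0) - m‖ ^ (2 * r) + τ ^ r) with hV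
    have hV0 : 0 ≤ V := mul_nonneg (H.w_nonneg _ _) (by positivity)
    calc ∫ y, ‖Y (Function.update x k y) - Y (Function.update x k 0)‖ ^ 2 ∂(ν k)
        ≤ ∫ y, (C * V) * (1 + ‖y‖) ^ (4 * p) ∂(ν k) := by
          refine integral_mono_of_nonneg (Eventually.of_forall fun _ => by positivity)
            ((H.integrable_moment k).const_mul _) (Eventually.of_forall fun y => ?_)
          have := hYle k (Function.update x k y)
          simp only [Function.update_idem, Function.update_self] at this
          refine this.trans (le_of_eq ?_)
          ring
      _ ≤ C * V * M := by
          rw [integral_const_mul]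
          exact mul_le_mul_of_nonneg_left (H.moment_le k) (by positivity)
      _ = C * M * V := by ring
      _ ≤ C * M * (2 * (324 ^ r + 1) * ∫ y, G k (Function.update x k y) ∂(ν k)) :=
          mul_le_mul_of_nonneg_left (H.weight_le_integral m r k x) (by positivity)
      _ = _ := by ring
  have hsum : ∑ k, ∫ x, G k x ∂(Measure.pi ν)
      ≤ τ * ((∫ x, ‖f x - m‖ ^ (2 * r) ∂(Measure.pi ν)) + τ ^ r) := by
    rw [← integral_finsetSum _ fun k _ => hGi k]
    calc ∫ x, ∑ k, G k x ∂(Measure.pi ν)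
        ≤ ∫ x, τ * (‖f x - m‖ ^ (2 * r) + τ ^ r) ∂(Measure.pi ν) := by
          refine integral_mono (integrable_finsetSum _ fun k _ => hGi k) (hfi.const_mul _)
            fun x => ?_
          simp only [hG, ← Finset.sum_mul]
          exact mul_le_mul_of_nonneg_right (H.sum_h_le x) (by positivity)
      _ = _ := by
          rw [integral_const_mul, integral_add (H.integrable_norm_pow m (2 * r))
            (integrable_const _)]
          simp
  calc ∑ k, ∫ x, ‖Y x - Y (Function.update x k 0)‖ ^ 2 ∂(Measure.pi ν)
      ≤ ∑ k, C * M * (2 * (324 ^ r + 1)) * ∫ x, G k x ∂(Measure.pi ν) :=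
        Finset.sum_le_sum fun k _ => hk k
    _ ≤ _ := by
        rw [← Finset.mul_sum]
        exact mul_le_mul_of_nonneg_left hsum (by positivity)

end LocalControl

/-- Moments of a function of independent variables which is controlled coordinatewise. -/
theorem exists_moment_bound (p : ℕ) (M : ℝ) (hM : 0 ≤ M) (q : ℕ) (hq : q ≤ p) :
    ∃ C : ℝ, 0 ≤ C ∧ ∀ (ι : Type) [Fintype ι] [DecidableEq ι] (ν : ι → Measure ℂ)
      [∀ i, IsProbabilityMeasure (ν i)] (f : (ι → ℂ) → ℂ) (w h : ι → (ι → ℂ) → ℝ) (b τ : ℝ),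
      LocalControl ν p M f w h b τ →
        ∫ x, ‖f x - ∫ y, f y ∂(Measure.pi ν)‖ ^ (2 * q) ∂(Measure.pi ν) ≤ C * τ ^ q := by
  induction q using Nat.strong_induction_on with
  | _ q ih =>
  rcases q with _ | _ | r
  · exact ⟨1, zero_le_one, fun ι _ _ ν _ f w h b τ H => by simp⟩
  -- For `q = 1`, Efron–Stein is applied to `f` itself with `r = 0`; the final factor 2 is the sum
  -- of the two zeroth powers.
  · refine ⟨M * (2 * (324 ^ 0 + 1)) * 2, by positivity, fun ι _ _ ν _ f w h b τ H => ?_⟩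
    have hs := H.sum_integral_increment_le 0 0 H.measurable_f H.norm_f_le zero_le_one hM
      (fun k x => by
        refine (H.increment_le k x).trans ?_
        have h1 : (1 + ‖x k‖) ^ 4 ≤ (1 + ‖x k‖) ^ (4 * p) :=
          pow_le_pow_right₀ (by linarith [norm_nonneg (x k)]) (by omega)
        have h2 := H.w_nonneg k (Function.update x k 0)
        simp only [mul_zero, pow_zero, one_mul]
        calc (1 + ‖x k‖) ^ 4 * w k (Function.update x k 0)
            ≤ (1 + ‖x k‖) ^ (4 * p) * w k (Function.update x k 0) := by gcongr
          _ ≤ (1 + ‖x k‖) ^ (4 * p) * (w k (Function.update x k 0) * (1 + 1)) := by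
              gcongr; linarith)
    have he := efron_stein ν 0 H.measurable_f H.norm_f_le
    simp only [zero_add, mul_one, pow_one]
    refine (he.trans hs).trans (le_of_eq ?_)
    simp
    ring
  -- For `q = r + 2 ≥ 2`, the exponents `q - 1`, `⌊q/2⌋` and `⌈q/2⌉` are all smaller than `q`. The
  -- first serves the variance, the other two Cauchy–Schwarz.
  · obtain ⟨C₁, hC₁, h₁⟩ := ih (r + 1) (by omega) (by omega)
    obtain ⟨C₂, hC₂, h₂⟩ := ih ((r + 2) / 2) (by omega) (by omega)
    obtain ⟨C₃, hC₃, h₃⟩ := ih (r + 2 - (r + 2) / 2) (by omega) (by omega)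
    set c : ℝ := ((r + 1 : ℕ) + 1) ^ 2 * 4 ^ (r + 1) with hc
    refine ⟨c * M * (2 * (324 ^ (r + 1) + 1)) * (C₁ + 1) + C₂ * C₃, by positivity,
      fun ι _ _ ν _ f w h b τ H => ?_⟩
    have hτ := H.tau_nonneg
    replace h₁ := h₁ ι ν f w h b τ H
    replace h₂ := h₂ ι ν f w h b τ H
    replace h₃ := h₃ ι ν f w h b τ H
    set m := ∫ y, f y ∂(Measure.pi ν) with hm
    set Y : (ι → ℂ) → ℂ := fun x => ((‖f x - m‖ ^ (r + 2) : ℝ) : ℂ) with hYdef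
    have hYm : Measurable Y := Complex.measurable_ofReal.comp
      ((H.measurable_f.sub measurable_const).norm.pow_const _)
    have hYn : ∀ x, ‖Y x‖ = ‖f x - m‖ ^ (r + 2) := fun x => by
      rw [hYdef]; simp
    have hYb : ∀ x, ‖Y x‖ ≤ (b + ‖m‖) ^ (r + 2) := fun x => by
      rw [hYn]
      gcongr
      exact (norm_sub_le _ _).trans (by gcongr; exact H.norm_f_le x)
    have hs := H.sum_integral_increment_le m (r + 1) (C := c) hYm hYb (by positivity) hM
      (fun k x => by
        have h1 := sq_pow_sub_pow_le (r + 1) (norm_nonneg (f x - m))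
          (norm_nonneg (f (Function.update x k 0) - m))
          (norm_nonneg (f x - f (Function.update x k 0)))
          (by
            refine (abs_norm_sub_norm_le _ _).trans (le_of_eq ?_)
            congr 1; ring)
          (one_le_pow₀ (by linarith [norm_nonneg (x k)]) : 1 ≤ (1 + ‖x k‖) ^ 4)
          (H.w_nonneg k (Function.update x k 0)) (H.w_update_le k x) (H.increment_le k x)
        have h2 : ((1 + ‖x k‖) ^ 4) ^ (r + 1 + 1) ≤ (1 + ‖x k‖) ^ (4 * p) := by
          rw [← pow_mul]
          exact pow_le_pow_right₀ (by linarith [norm_nonneg (x k)]) (by omega)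
        have h3 : ‖Y x - Y (Function.update x k 0)‖ ^ 2 = (‖f x - m‖ ^ (r + 1 + 1)
            - ‖f (Function.update x k 0) - m‖ ^ (r + 1 + 1)) ^ 2 := by
          rw [hYdef]
          simp only
          rw [← Complex.ofReal_sub, Complex.norm_real, Real.norm_eq_abs, sq_abs]
        rw [h3]
        refine h1.trans ?_
        have h4 := H.w_nonneg k (Function.update x k 0)
        gcongr)
    have he := efron_stein ν 0 hYm hYb
    have hid := integral_norm_sub_sq (ρ := Measure.pi ν) hYm hYb 0
    simp only [sub_zero, hYn] at hid
    have h_int : ∫ y, Y y ∂(Measure.pi ν)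
        = ((∫ y, ‖f y - m‖ ^ ((r + 2) / 2) * ‖f y - m‖ ^ (r + 2 - (r + 2) / 2)
            ∂(Measure.pi ν) : ℝ) : ℂ) := by
      simp only [hYdef]
      rw [integral_complex_ofReal]
      congr 1
      refine integral_congr_ae (Eventually.of_forall fun y => ?_)
      simp only
      rw [← pow_add]
      congr 1
      omega
    have hcs : ‖∫ y, Y y ∂(Measure.pi ν)‖ ^ 2 ≤ (C₂ * τ ^ ((r + 2) / 2))
        * (C₃ * τ ^ (r + 2 - (r + 2) / 2)) := by
      rw [h_int, Complex.norm_real, Real.norm_eq_abs, sq_abs]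
      have key := sq_integral_mul_le (ρ := Measure.pi ν)
        (f := fun y => ‖f y - m‖ ^ ((r + 2) / 2))
        (g := fun y => ‖f y - m‖ ^ (r + 2 - (r + 2) / 2))
        (by simpa only [← pow_mul] using H.integrable_norm_pow m _)
        (by simpa only [← pow_mul] using H.integrable_norm_pow m _)
        (by simpa only [← pow_add] using H.integrable_norm_pow m _)
      refine key.trans ?_
      simp only [← pow_mul, mul_comm _ 2]
      exact mul_le_mul h₂ h₃ (integral_nonneg fun _ => by positivity) (by positivity)
    have hlhs : ∫ x, ‖f x - m‖ ^ (2 * (r + 1 + 1)) ∂(Measure.pi ν)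
        = ∫ x, (‖f x - m‖ ^ (r + 2)) ^ 2 ∂(Measure.pi ν) := by
      simp only [← pow_mul, mul_comm 2]
    rw [hlhs, hid]
    have hpow : τ ^ ((r + 2) / 2) * τ ^ (r + 2 - (r + 2) / 2) = τ ^ (r + 2) := by
      rw [← pow_add]; congr 1; omega
    have hfin : c * M * (2 * (324 ^ (r + 1) + 1)) *
        (τ * ((∫ x, ‖f x - m‖ ^ (2 * (r + 1)) ∂(Measure.pi ν)) + τ ^ (r + 1)))
        ≤ c * M * (2 * (324 ^ (r + 1) + 1)) * (τ * (C₁ * τ ^ (r + 1) + τ ^ (r + 1))) := by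
      gcongr
    calc _ ≤ c * M * (2 * (324 ^ (r + 1) + 1)) * (τ * (C₁ * τ ^ (r + 1) + τ ^ (r + 1)))
          + (C₂ * τ ^ ((r + 2) / 2)) * (C₃ * τ ^ (r + 2 - (r + 2) / 2)) :=
          add_le_add ((he.trans hs).trans hfin) hcs
      _ = c * M * (2 * (324 ^ (r + 1) + 1)) * (C₁ + 1) * τ ^ (r + 1 + 1)
          + C₂ * C₃ * (τ ^ ((r + 2) / 2) * τ ^ (r + 2 - (r + 2) / 2)) := by ring
      _ = _ := by rw [hpow]; ring

end MomentBound

/-! ### The linearized resolvent and its norm. -/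

section Linearization

/-- Homogeneity: for `a > 0` the point `s / a` lies in `ℝ⁺`. -/
theorem distNonneg_mul_le (z : ℂ) {s a : ℝ} (hs : 0 ≤ s) (ha : 0 ≤ a) :
    distNonneg z * a ≤ ‖(s : ℂ) - z * a‖ := by
  rcases ha.eq_or_lt with rfl | ha
  · simp
  · have h : distNonneg z ≤ dist z ((s / a : ℝ) : ℂ) :=
      Metric.infDist_le_dist_of_mem ⟨s / a, by simpa using div_nonneg hs ha.le, rfl⟩
    have ha' : (a : ℂ) ≠ 0 := by exact_mod_cast ha.ne'
    have e : (s : ℂ) - z * a = (((s / a : ℝ) : ℂ) - z) * a := by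
      push_cast; field_simp
    rw [e, norm_mul, Complex.norm_real, Real.norm_of_nonneg ha.le, ← dist_eq_norm, dist_comm]
    gcongr

theorem distNonneg_pos {z : ℂ} (hz : z ∉ nonnegReals) : 0 < distNonneg z := by
  have hc : IsClosed nonnegReals :=
    Complex.isometry_ofReal.isClosedEmbedding.isClosedMap _ isClosed_Ici
  exact (hc.notMem_iff_infDist_pos ⟨0, 0, by simp, by simp⟩).1 hz

/-- A bound for the inverse of the linearized resolvent. -/
noncomputable def kap (z : ℂ) : ℝ := 3 * ((1 + ‖z‖) * (1 + 1 / distNonneg z))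

theorem one_le_kap (z : ℂ) : 1 ≤ kap z := by
  have h1 : 0 ≤ 1 / distNonneg z := one_div_nonneg.2 Metric.infDist_nonneg
  have h2 := norm_nonneg z
  rw [kap]
  nlinarith [mul_nonneg h2 h1]

variable {m n : Type*} [Fintype m] [Fintype n] [DecidableEq m] [DecidableEq n]

/-- The linearization of `S Sᴴ - z`, whose inverse has `(S Sᴴ - z)⁻¹` as its first block. -/
def linMat {m n : Type*} [DecidableEq m] [DecidableEq n] (z : ℂ) (S : Matrix m n ℂ) : Matrix (m ⊕ n) (m ⊕ n) ℂ :=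
  fromBlocks (-(z • (1 : Matrix m m ℂ))) S Sᴴ (-1)

theorem norm_dotProduct_star_le {k : Type*} [Fintype k] (a b : k → ℂ) :
    ‖star a ⬝ᵥ b‖ ≤ ‖WithLp.toLp 2 a‖ * ‖WithLp.toLp 2 b‖ := by
  have h := norm_inner_le_norm (𝕜 := ℂ) (WithLp.toLp 2 a) (WithLp.toLp 2 b)
  rwa [EuclideanSpace.inner_eq_star_dotProduct, dotProduct_comm] at h

theorem star_dotProduct_self {k : Type*} [Fintype k] (a : k → ℂ) :
    star a ⬝ᵥ a = ((‖WithLp.toLp 2 a‖ ^ 2 : ℝ) : ℂ) := by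
  have h := inner_self_eq_norm_sq_to_K (𝕜 := ℂ) (WithLp.toLp 2 a)
  rw [EuclideanSpace.inner_eq_star_dotProduct, dotProduct_comm] at h
  rw [h]; push_cast; rfl

theorem norm_toLp_sum_sq {m n : Type*} [Fintype m] [Fintype n] (y : m ⊕ n → ℂ) :
    ‖WithLp.toLp 2 y‖ ^ 2
      = ‖WithLp.toLp 2 (y ∘ Sum.inl)‖ ^ 2 + ‖WithLp.toLp 2 (y ∘ Sum.inr)‖ ^ 2 := by
  simp [EuclideanSpace.norm_sq_eq]

/-- Pairing the image with `(x, Sᴴ x)` eliminates `q` and leaves `‖Sᴴ x‖² - z ‖x‖²`, which controls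
both `‖x‖²` and `‖Sᴴ x‖²` because `z` is away from `ℝ⁺`. No bound on `S` enters. -/
theorem norm_le_kap_mul {z : ℂ} (hz : z ∉ nonnegReals) (S : Matrix m n ℂ) (y : m ⊕ n → ℂ) :
    ‖WithLp.toLp 2 y‖ ≤ kap z * ‖WithLp.toLp 2 (linMat z S *ᵥ y)‖ := by
  have hδ := distNonneg_pos hz
  set x := y ∘ Sum.inl with hx
  set q := y ∘ Sum.inr with hq
  set g := -(z • x) + S *ᵥ q with hg
  set h := Sᴴ *ᵥ x - q with hh
  have hM : linMat z S *ᵥ y = Sum.elim g h := by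
    rw [linMat, fromBlocks_mulVec, hg, hh]
    congr 1
    · rw [neg_mulVec, smul_mulVec, one_mulVec]
    · rw [neg_mulVec, one_mulVec, sub_eq_add_neg]
  set F := ‖WithLp.toLp 2 (linMat z S *ᵥ y)‖ with hF
  have hFsq : F ^ 2 = ‖WithLp.toLp 2 g‖ ^ 2 + ‖WithLp.toLp 2 h‖ ^ 2 := by
    rw [hF, norm_toLp_sum_sq, hM]; rfl
  have hF0 : 0 ≤ F := norm_nonneg _
  have hgF : ‖WithLp.toLp 2 g‖ ≤ F := by
    refine abs_le_of_sq_le_sq' ?_ hF0 |>.2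
    nlinarith [sq_nonneg ‖WithLp.toLp 2 h‖]
  have hhF : ‖WithLp.toLp 2 h‖ ≤ F := by
    refine abs_le_of_sq_le_sq' ?_ hF0 |>.2
    nlinarith [sq_nonneg ‖WithLp.toLp 2 g‖]
  set P := ‖WithLp.toLp 2 x‖ with hP
  set r := ‖WithLp.toLp 2 (Sᴴ *ᵥ x)‖ with hr
  have hP0 : 0 ≤ P := norm_nonneg _
  have hr0 : 0 ≤ r := norm_nonneg _
  have hid : ((r ^ 2 : ℝ) : ℂ) - z * ((P ^ 2 : ℝ) : ℂ)
      = star x ⬝ᵥ g + star (Sᴴ *ᵥ x) ⬝ᵥ h := by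
    have e1 : star x ⬝ᵥ (S *ᵥ q) = star (Sᴴ *ᵥ x) ⬝ᵥ q := by
      rw [star_mulVec, conjTranspose_conjTranspose, dotProduct_mulVec]
    rw [hr, hP, ← star_dotProduct_self, ← star_dotProduct_self, hg, hh, dotProduct_add,
      dotProduct_sub, dotProduct_neg, dotProduct_smul, e1, smul_eq_mul]
    ring
  set T := ‖((r ^ 2 : ℝ) : ℂ) - z * ((P ^ 2 : ℝ) : ℂ)‖ with hT
  have hTle : T ≤ (P + r) * F := by
    rw [hT, hid]
    refine (norm_add_le _ _).trans ?_
    rw [add_mul]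
    refine add_le_add ((norm_dotProduct_star_le _ _).trans ?_)
      ((norm_dotProduct_star_le _ _).trans ?_)
    · gcongr
    · gcongr
  have h1 : distNonneg z * P ^ 2 ≤ T := distNonneg_mul_le z (sq_nonneg r) (sq_nonneg P)
  have h2 : r ^ 2 ≤ T + ‖z‖ * P ^ 2 := by
    have := norm_add_le (((r ^ 2 : ℝ) : ℂ) - z * ((P ^ 2 : ℝ) : ℂ)) (z * ((P ^ 2 : ℝ) : ℂ))
    rw [sub_add_cancel, norm_mul, Complex.norm_real, Complex.norm_real,
      Real.norm_of_nonneg (sq_nonneg r), Real.norm_of_nonneg (sq_nonneg P)] at this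
    exact this
  set B := (1 + ‖z‖) * (1 + 1 / distNonneg z) with hB
  have hz0 := norm_nonneg z
  have hT0 : 0 ≤ T := norm_nonneg _
  have hd0 : 0 < 1 / distNonneg z := one_div_pos.2 hδ
  have h3 : P ^ 2 ≤ 1 / distNonneg z * T := by
    rw [one_div, ← div_eq_inv_mul, le_div_iff₀ hδ]; linarith
  have hB1 : 1 ≤ B := by rw [hB]; nlinarith [mul_nonneg hz0 hd0.le]
  have h4 : P ^ 2 + r ^ 2 ≤ B * T := by
    have h5 : (1 + ‖z‖) * P ^ 2 ≤ (1 + ‖z‖) * (1 / distNonneg z * T) := by gcongr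
    have h6 : B * T = T + ‖z‖ * T + (1 + ‖z‖) * (1 / distNonneg z * T) := by rw [hB]; ring
    nlinarith [mul_nonneg hz0 hT0]
  have h7 : P + r ≤ 2 * B * F := by
    rcases (add_nonneg hP0 hr0).eq_or_lt with h0 | h0
    · rw [← h0]; positivity
    · have h8 : (P + r) * (P + r) ≤ (2 * B * F) * (P + r) := by
        have h9 : B * T ≤ B * ((P + r) * F) := by gcongr
        nlinarith [sq_nonneg (P - r)]
      exact le_of_mul_le_mul_right h8 h0
  have hqle : ‖WithLp.toLp 2 q‖ ≤ r + F := by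
    have e : WithLp.toLp 2 q = WithLp.toLp 2 (Sᴴ *ᵥ x) - WithLp.toLp 2 h := by
      rw [hh, ← WithLp.toLp_sub]; congr 1; ring
    rw [e]
    exact (norm_sub_le _ _).trans (by gcongr)
  have hyle : ‖WithLp.toLp 2 y‖ ≤ P + ‖WithLp.toLp 2 q‖ := by
    refine abs_le_of_sq_le_sq' ?_ (by positivity) |>.2
    rw [norm_toLp_sum_sq y]
    nlinarith [mul_nonneg hP0 (norm_nonneg (WithLp.toLp 2 q))]
  rw [kap, ← hB]
  -- The total is at most `P + r + F ≤ 2 B F + F ≤ 3 B F`, whence the 3 in `kap`.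
  nlinarith [mul_nonneg (sub_nonneg.2 hB1) hF0]

theorem isUnit_det_linMat {z : ℂ} (hz : z ∉ nonnegReals) (S : Matrix m n ℂ) :
    IsUnit (linMat z S).det := by
  rw [← isUnit_iff_isUnit_det, ← mulVec_injective_iff_isUnit]
  intro y y' hyy
  have h := norm_le_kap_mul hz S (y - y')
  rw [mulVec_sub, sub_eq_zero.2 hyy] at h
  simp only [WithLp.toLp_zero, norm_zero, mul_zero] at h
  have := norm_le_zero_iff.1 h
  exact sub_eq_zero.1 (congrArg WithLp.ofLp this)

theorem linMat_mul_inv {z : ℂ} (hz : z ∉ nonnegReals) (S : Matrix m n ℂ) :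
    linMat z S * (linMat z S)⁻¹ = 1 := mul_nonsing_inv _ (isUnit_det_linMat hz S)

theorem inv_mul_linMat {z : ℂ} (hz : z ∉ nonnegReals) (S : Matrix m n ℂ) :
    (linMat z S)⁻¹ * linMat z S = 1 := nonsing_inv_mul _ (isUnit_det_linMat hz S)

theorem norm_inv_mulVec_le {z : ℂ} (hz : z ∉ nonnegReals) (S : Matrix m n ℂ) (v : m ⊕ n → ℂ) :
    ‖WithLp.toLp 2 ((linMat z S)⁻¹ *ᵥ v)‖ ≤ kap z * ‖WithLp.toLp 2 v‖ := by
  have h := norm_le_kap_mul hz S ((linMat z S)⁻¹ *ᵥ v)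
  rwa [mulVec_mulVec, linMat_mul_inv hz, one_mulVec] at h

open scoped Matrix.Norms.L2Operator in
theorem norm_vecMul_inv_le {z : ℂ} (hz : z ∉ nonnegReals) (S : Matrix m n ℂ) (u : m ⊕ n → ℂ) :
    ‖WithLp.toLp 2 (u ᵥ* (linMat z S)⁻¹)‖ ≤ kap z * ‖WithLp.toLp 2 u‖ := by
  have hk : 0 ≤ kap z := zero_le_one.trans (one_le_kap z)
  have hop : ‖(linMat z S)⁻¹‖ ≤ kap z := by
    rw [l2_opNorm_def]
    refine ContinuousLinearMap.opNorm_le_bound _ hk fun v => ?_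
    exact norm_inv_mulVec_le hz S (WithLp.ofLp v)
  have hstar : ∀ a : m ⊕ n → ℂ, ‖WithLp.toLp 2 (star a)‖ = ‖WithLp.toLp 2 a‖ := fun a => by
    simp [EuclideanSpace.norm_eq]
  have h := l2_opNorm_mulVec ((linMat z S)⁻¹)ᴴ (WithLp.toLp 2 (star u))
  rw [l2_opNorm_conjTranspose, hstar] at h
  have e : (((linMat z S)⁻¹)ᴴ *ᵥ star u) = star (u ᵥ* (linMat z S)⁻¹) := by
    rw [star_vecMul]
  change ‖WithLp.toLp 2 (((linMat z S)⁻¹)ᴴ *ᵥ star u)‖ ≤ _ at h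
  rw [e, hstar] at h
  exact h.trans (by gcongr)

theorem norm_inv_apply_le {z : ℂ} (hz : z ∉ nonnegReals) (S : Matrix m n ℂ) (r s : m ⊕ n) :
    ‖(linMat z S)⁻¹ r s‖ ≤ kap z := by
  have h := norm_inv_mulVec_le hz S (Pi.single s 1)
  have h1 : ‖WithLp.toLp 2 (Pi.single s 1 : m ⊕ n → ℂ)‖ = 1 := by
    simp
  rw [h1, mul_one, mulVec_single_one] at h
  exact (PiLp.norm_apply_le (WithLp.toLp 2 ((linMat z S)⁻¹.col s)) r).trans h

/-- The first block of the inverse of the linearization is the resolvent. -/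
theorem dotProduct_inv_linMat {z : ℂ} (hz : z ∉ nonnegReals) (S : Matrix m n ℂ) (a b : m → ℂ) :
    Sum.elim a 0 ⬝ᵥ ((linMat z S)⁻¹ *ᵥ Sum.elim b 0)
      = a ⬝ᵥ ((S * Sᴴ - z • (1 : Matrix m m ℂ))⁻¹ *ᵥ b) := by
  set R := S * Sᴴ - z • (1 : Matrix m m ℂ) with hR
  -- `R` is the Schur complement of the block `-1`, so it inherits invertibility from the
  -- linearization.
  have hdet : IsUnit R.det := by
    have h := isUnit_det_linMat hz S
    let : Invertible (1 : Matrix n n ℂ) := invertibleOne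
    let : Invertible (-1 : Matrix n n ℂ) := invertibleNeg 1
    rw [linMat, det_fromBlocks₂₂] at h
    have h' := isUnit_of_mul_isUnit_right h
    have e : -(z • (1 : Matrix m m ℂ)) - S * ⅟(-1 : Matrix n n ℂ) * Sᴴ = R := by
      rw [invOf_neg, invOf_one, hR]
      simp only [Matrix.mul_neg, Matrix.mul_one, Matrix.neg_mul]
      abel
    rwa [e] at h'
  set y := (linMat z S)⁻¹ *ᵥ Sum.elim b 0 with hy
  have hMy : linMat z S *ᵥ y = Sum.elim b 0 := by
    rw [hy, mulVec_mulVec, linMat_mul_inv hz, one_mulVec]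
  rw [linMat, fromBlocks_mulVec] at hMy
  have e1 := congrArg (fun f => f ∘ Sum.inl) hMy
  have e2 := congrArg (fun f => f ∘ Sum.inr) hMy
  simp only [Sum.elim_comp_inl, Sum.elim_comp_inr] at e1 e2
  have e3 : y ∘ Sum.inr = Sᴴ *ᵥ (y ∘ Sum.inl) := by
    rw [neg_mulVec, one_mulVec, add_neg_eq_zero] at e2
    exact e2.symm
  have e4 : R *ᵥ (y ∘ Sum.inl) = b := by
    rw [e3, mulVec_mulVec] at e1
    rw [hR, sub_mulVec, ← e1, neg_mulVec]
    abel
  have e5 : R⁻¹ *ᵥ b = y ∘ Sum.inl := by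
    rw [← e4, mulVec_mulVec, nonsing_inv_mul _ hdet, one_mulVec]
  rw [e5]
  simp [dotProduct, Fintype.sum_sum_type]

end Linearization

/-! ### Changing one entry of the matrix. -/

section Perturbation

variable {k : Type*} [Fintype k] [DecidableEq k]

/-- The effect of changing two symmetric entries on a bilinear form of the inverse. -/
theorem dotProduct_inv_sub {M₀ M₁ G₀ G₁ : Matrix k k ℂ} {r s : k} {ξ η : ℂ}
    (h₀ : M₀ * G₀ = 1) (h₁ : G₁ * M₁ = 1) (hM : M₁ = M₀ + (single r s ξ + single s r η))
    (U V : k → ℂ) :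
    U ⬝ᵥ (G₁ *ᵥ V) = U ⬝ᵥ (G₀ *ᵥ V)
      - (ξ * (U ᵥ* G₁) r * (G₀ *ᵥ V) s + η * (U ᵥ* G₁) s * (G₀ *ᵥ V) r) := by
  -- The mixed resolvent identity is exact: the left vector sees `G₁` and the right vector `G₀`.
  have hG : G₁ = G₀ - G₁ * (single r s ξ + single s r η) * G₀ := by
    have : single r s ξ + single s r η = M₁ - M₀ := by rw [hM]; abel
    rw [this, Matrix.mul_sub, Matrix.sub_mul, h₁, Matrix.mul_assoc, h₀]
    simp
  have hs : ∀ (i j : k) (c : ℂ), (U ᵥ* G₁) ⬝ᵥ (single i j c *ᵥ (G₀ *ᵥ V))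
      = c * (U ᵥ* G₁) i * (G₀ *ᵥ V) j := by
    intro i j c
    rw [single_mulVec]
    simp [dotProduct, Function.update_apply]
    ring
  conv_lhs => rw [hG]
  rw [sub_mulVec, dotProduct_sub, ← mulVec_mulVec, ← mulVec_mulVec, dotProduct_mulVec U G₁,
    add_mulVec, dotProduct_add, hs, hs]

variable {M₀ M₁ G₀ G₁ : Matrix k k ℂ} {r s : k} {ξ : ℂ} {κ : ℝ}

theorem norm_inv_mulVec_apply_le (h₀ : M₀ * G₀ = 1) (h₁ : G₁ * M₁ = 1)
    (hM : M₁ = M₀ + (single r s ξ + single s r (star ξ))) (hκ : ∀ i j, ‖G₁ i j‖ ≤ κ)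
    (V : k → ℂ) (t : k) :
    ‖(G₁ *ᵥ V) t‖ ≤ ‖(G₀ *ᵥ V) t‖
      + ‖ξ‖ * κ * (‖(G₀ *ᵥ V) r‖ + ‖(G₀ *ᵥ V) s‖) := by
  have h := dotProduct_inv_sub h₀ h₁ hM (Pi.single t 1) V
  simp only [single_one_dotProduct, single_one_vecMul, row_apply] at h
  rw [h]
  refine (norm_sub_le _ _).trans (add_le_add_right ((norm_add_le _ _).trans ?_) _)
  rw [norm_mul, norm_mul, norm_mul, norm_mul, norm_star]
  have e1 : ‖ξ‖ * ‖G₁ t r‖ * ‖(G₀ *ᵥ V) s‖ ≤ ‖ξ‖ * κ * ‖(G₀ *ᵥ V) s‖ := by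
    gcongr; exact hκ _ _
  have e2 : ‖ξ‖ * ‖G₁ t s‖ * ‖(G₀ *ᵥ V) r‖ ≤ ‖ξ‖ * κ * ‖(G₀ *ᵥ V) r‖ := by
    gcongr; exact hκ _ _
  linarith

theorem norm_vecMul_inv_apply_le (h₀ : M₀ * G₀ = 1) (h₁ : G₁ * M₁ = 1)
    (hM : M₁ = M₀ + (single r s ξ + single s r (star ξ))) (hκ : ∀ i j, ‖G₀ i j‖ ≤ κ)
    (U : k → ℂ) (t : k) :
    ‖(U ᵥ* G₀) t‖ ≤ ‖(U ᵥ* G₁) t‖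
      + ‖ξ‖ * κ * (‖(U ᵥ* G₁) r‖ + ‖(U ᵥ* G₁) s‖) := by
  have h := dotProduct_inv_sub h₀ h₁ hM U (Pi.single t 1)
  rw [dotProduct_mulVec, dotProduct_mulVec] at h
  simp only [dotProduct_single_one, mulVec_single_one, col_apply] at h
  rw [eq_sub_iff_add_eq] at h
  rw [← h]
  refine (norm_add_le _ _).trans (add_le_add_right ((norm_add_le _ _).trans ?_) _)
  rw [norm_mul, norm_mul, norm_mul, norm_mul, norm_star]
  have e1 : ‖ξ‖ * ‖(U ᵥ* G₁) r‖ * ‖G₀ s t‖ ≤ ‖ξ‖ * ‖(U ᵥ* G₁) r‖ * κ := by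
    gcongr; exact hκ _ _
  have e2 : ‖ξ‖ * ‖(U ᵥ* G₁) s‖ * ‖G₀ r t‖ ≤ ‖ξ‖ * ‖(U ᵥ* G₁) s‖ * κ := by
    gcongr; exact hκ _ _
  linarith

end Perturbation

/-! ### Elementary inequalities for the weights. -/

section Weight

/-- The weight attached to an entry of the matrix: `a, a'` are the components of the left vector
at the row and column of the entry, `c, c'` those of the right vector. -/
def weight (e a a' c c' : ℝ) : ℝ :=
  a ^ 2 * c' ^ 2 + a' ^ 2 * c ^ 2 + e * (a ^ 2 * c ^ 2 + a' ^ 2 * c' ^ 2)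

theorem weight_nonneg {e : ℝ} (he : 0 ≤ e) (a a' c c' : ℝ) : 0 ≤ weight e a a' c c' := by
  unfold weight; positivity

/-- The mixed identity has the left vector at the zeroed point (`a`, `a'`) and the right one at the
actual point (`c₁`, `c₁'`). Moving the latter to the zeroed point costs a term in `t²`, whose square
carries `e²`; the spare factor `e` is what permits the products `a c` and `a' c'`, and explains
their coefficient in `weight`. -/
theorem sq_increment_le {e K κ y t a a' c c' c₁ c₁' D : ℝ} (he : 0 ≤ e) (he1 : e ≤ 1)
    (hK : 0 ≤ K) (hκ : 1 ≤ κ) (hy : 0 ≤ y) (ht : 0 ≤ t) (ha : 0 ≤ a) (ha' : 0 ≤ a')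
    (htK : t ^ 2 ≤ K * e * y ^ 2) (hD : 0 ≤ D)
    (hc₁ : c₁ ≤ c + t * κ * (c + c')) (hc₁' : c₁' ≤ c' + t * κ * (c + c'))
    (hDle : D ≤ t * (a * c₁' + a' * c₁)) :
    D ^ 2 ≤ (1 + y) ^ 4 * ((4 * K + 8 * K ^ 2) * κ ^ 2 * e * weight e a a' c c') := by
  have hw := weight_nonneg he a a' c c'
  have h1 : D ≤ t * (a * c' + a' * c) + t ^ 2 * κ * ((a + a') * (c + c')) := by
    refine hDle.trans ?_
    have : a * c₁' + a' * c₁ ≤ a * (c' + t * κ * (c + c')) + a' * (c + t * κ * (c + c')) := by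
      gcongr
    calc t * (a * c₁' + a' * c₁)
        ≤ t * (a * (c' + t * κ * (c + c')) + a' * (c + t * κ * (c + c'))) := by gcongr
      _ = _ := by ring
  have h2 : D ^ 2 ≤ 2 * (t * (a * c' + a' * c)) ^ 2
      + 2 * (t ^ 2 * κ * ((a + a') * (c + c'))) ^ 2 := by
    have := pow_le_pow_left₀ hD h1 2
    nlinarith [sq_nonneg (t * (a * c' + a' * c) - t ^ 2 * κ * ((a + a') * (c + c')))]
  have h3 : (a * c' + a' * c) ^ 2 ≤ 2 * weight e a a' c c' := by
    unfold weight
    have : 0 ≤ e * (a ^ 2 * c ^ 2 + a' ^ 2 * c' ^ 2) := by positivity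
    nlinarith [sq_nonneg (a * c' - a' * c)]
  have h4 : e * ((a + a') * (c + c')) ^ 2 ≤ 4 * weight e a a' c c' := by
    have i1 : (a + a') ^ 2 ≤ 2 * (a ^ 2 + a' ^ 2) := by nlinarith [sq_nonneg (a - a')]
    have i2 : (c + c') ^ 2 ≤ 2 * (c ^ 2 + c' ^ 2) := by nlinarith [sq_nonneg (c - c')]
    have i3 : ((a + a') * (c + c')) ^ 2 ≤ (2 * (a ^ 2 + a' ^ 2)) * (2 * (c ^ 2 + c' ^ 2)) := by
      rw [mul_pow]; gcongr
    have i4 : e * (a ^ 2 * c' ^ 2 + a' ^ 2 * c ^ 2) ≤ 1 * (a ^ 2 * c' ^ 2 + a' ^ 2 * c ^ 2) := by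
      gcongr
    have i5 := mul_le_mul_of_nonneg_left i3 he
    unfold weight
    linarith
  have h5 : t ^ 4 ≤ K ^ 2 * e ^ 2 * y ^ 4 := by
    have := pow_le_pow_left₀ (sq_nonneg t) htK 2
    linarith
  have hy2 : y ^ 2 ≤ (1 + y) ^ 4 := by
    calc y ^ 2 ≤ (1 + y) ^ 2 := by gcongr; linarith
      _ ≤ (1 + y) ^ 4 := pow_le_pow_right₀ (by linarith) (by norm_num)
  have hy4 : y ^ 4 ≤ (1 + y) ^ 4 := by gcongr; linarith
  have hκ2 : 1 ≤ κ ^ 2 := one_le_pow₀ hκ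
  set w := weight e a a' c c' with hwdef
  calc D ^ 2 ≤ 2 * (t ^ 2 * (a * c' + a' * c) ^ 2)
        + 2 * (t ^ 4 * (κ ^ 2 * ((a + a') * (c + c')) ^ 2)) := h2.trans (le_of_eq (by ring))
    _ ≤ 2 * ((K * e * y ^ 2) * (2 * w))
        + 2 * ((K ^ 2 * e ^ 2 * y ^ 4) * (κ ^ 2 * ((a + a') * (c + c')) ^ 2)) := by gcongr
    _ = 4 * K * e * w * y ^ 2
        + 2 * K ^ 2 * e * y ^ 4 * κ ^ 2 * (e * ((a + a') * (c + c')) ^ 2) := by ring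
    _ ≤ 4 * K * e * w * ((1 + y) ^ 4 * κ ^ 2)
        + 2 * K ^ 2 * e * (1 + y) ^ 4 * κ ^ 2 * (4 * w) := by
        gcongr
        exact hy2.trans (le_mul_of_one_le_right (by positivity) hκ2)
    _ = _ := by ring

theorem sq_le_of_le_add {e K κ t a b b' : ℝ} (he : 0 ≤ e) (he1 : e ≤ 1) (hK : 0 ≤ K)
    (hκ : 1 ≤ κ) (ha : 0 ≤ a)
    (htK : t ^ 2 ≤ 4 * K * e) (h : a ≤ b + t * κ * (b + b')) :
    a ^ 2 ≤ (2 + 16 * K) * κ ^ 2 * (b ^ 2 + e * b' ^ 2) := by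
  have hκ2 : 1 ≤ κ ^ 2 := one_le_pow₀ hκ
  have h1 : a ^ 2 ≤ 2 * b ^ 2 + 4 * (t ^ 2 * κ ^ 2) * (b ^ 2 + b' ^ 2) := by
    have h2 := pow_le_pow_left₀ ha h 2
    have h3 : (b + b') ^ 2 ≤ 2 * (b ^ 2 + b' ^ 2) := by nlinarith [sq_nonneg (b - b')]
    have h4 : (t * κ * (b + b')) ^ 2 ≤ (t * κ) ^ 2 * (2 * (b ^ 2 + b' ^ 2)) := by
      rw [mul_pow]; gcongr
    nlinarith [sq_nonneg (b - t * κ * (b + b'))]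
  calc a ^ 2 ≤ 2 * b ^ 2 + 4 * (t ^ 2 * κ ^ 2) * (b ^ 2 + b' ^ 2) := h1
    _ ≤ 2 * b ^ 2 + 4 * ((4 * K * e) * κ ^ 2) * (b ^ 2 + b' ^ 2) := by gcongr
    _ = 2 * b ^ 2 * 1 + 16 * K * κ ^ 2 * (e * b ^ 2 + e * b' ^ 2) := by ring
    _ ≤ 2 * b ^ 2 * κ ^ 2 + 16 * K * κ ^ 2 * (1 * b ^ 2 + e * b' ^ 2)
        + 2 * κ ^ 2 * (e * b' ^ 2) := by
        have : 0 ≤ 2 * κ ^ 2 * (e * b' ^ 2) := by positivity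
        have : 2 * b ^ 2 * 1 + 16 * K * κ ^ 2 * (e * b ^ 2 + e * b' ^ 2)
          ≤ 2 * b ^ 2 * κ ^ 2 + 16 * K * κ ^ 2 * (1 * b ^ 2 + e * b' ^ 2) := by gcongr
        linarith
    _ = _ := by ring

/-- The form of `weight` is stable under mixing row and column components at relative size `e`: each
product expands into the four monomials of the weight, with coefficients no larger since `e³ ≤ e² ≤
e ≤ 1`. -/
theorem weight_le_weight {e L a a' c c' b b' d d' : ℝ} (he : 0 ≤ e) (he1 : e ≤ 1) (hL : 0 ≤ L)
    (ha : a ^ 2 ≤ L * (b ^ 2 + e * b' ^ 2)) (ha' : a' ^ 2 ≤ L * (b' ^ 2 + e * b ^ 2))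
    (hc : c ^ 2 ≤ L * (d ^ 2 + e * d' ^ 2)) (hc' : c' ^ 2 ≤ L * (d' ^ 2 + e * d ^ 2)) :
    weight e a a' c c' ≤ 4 * L ^ 2 * weight e b b' d d' := by
  have he2 : e ^ 2 ≤ e := by nlinarith
  have he3 : e ^ 3 ≤ e := by nlinarith [mul_le_mul_of_nonneg_left he2 he]
  have e21 : e ^ 2 ≤ 1 := he2.trans he1
  have p1 : 0 ≤ b ^ 2 * d ^ 2 := by positivity
  have p2 : 0 ≤ b ^ 2 * d' ^ 2 := by positivity
  have p3 : 0 ≤ b' ^ 2 * d ^ 2 := by positivity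
  have p4 : 0 ≤ b' ^ 2 * d' ^ 2 := by positivity
  have m1 : a ^ 2 * c' ^ 2 ≤ L ^ 2 * weight e b b' d d' := by
    calc a ^ 2 * c' ^ 2 ≤ (L * (b ^ 2 + e * b' ^ 2)) * (L * (d' ^ 2 + e * d ^ 2)) := by gcongr
      _ = L ^ 2 * (b ^ 2 * d' ^ 2 + e * (b ^ 2 * d ^ 2 + b' ^ 2 * d' ^ 2)
          + e ^ 2 * (b' ^ 2 * d ^ 2)) := by ring
      _ ≤ L ^ 2 * weight e b b' d d' := by
        refine mul_le_mul_of_nonneg_left ?_ (sq_nonneg L)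
        unfold weight; linarith [mul_le_mul_of_nonneg_right e21 p3]
  have m2 : a' ^ 2 * c ^ 2 ≤ L ^ 2 * weight e b b' d d' := by
    calc a' ^ 2 * c ^ 2 ≤ (L * (b' ^ 2 + e * b ^ 2)) * (L * (d ^ 2 + e * d' ^ 2)) := by gcongr
      _ = L ^ 2 * (b' ^ 2 * d ^ 2 + e * (b ^ 2 * d ^ 2 + b' ^ 2 * d' ^ 2)
          + e ^ 2 * (b ^ 2 * d' ^ 2)) := by ring
      _ ≤ L ^ 2 * weight e b b' d d' := by
        refine mul_le_mul_of_nonneg_left ?_ (sq_nonneg L)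
        unfold weight; linarith [mul_le_mul_of_nonneg_right e21 p2]
  have m3 : e * (a ^ 2 * c ^ 2) ≤ L ^ 2 * weight e b b' d d' := by
    calc e * (a ^ 2 * c ^ 2)
        ≤ e * ((L * (b ^ 2 + e * b' ^ 2)) * (L * (d ^ 2 + e * d' ^ 2))) := by gcongr
      _ = L ^ 2 * (e * (b ^ 2 * d ^ 2) + e ^ 2 * (b ^ 2 * d' ^ 2 + b' ^ 2 * d ^ 2)
          + e ^ 3 * (b' ^ 2 * d' ^ 2)) := by ring
      _ ≤ L ^ 2 * weight e b b' d d' := by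
        refine mul_le_mul_of_nonneg_left ?_ (sq_nonneg L)
        unfold weight
        linarith [mul_le_mul_of_nonneg_right e21 (add_nonneg p2 p3),
          mul_le_mul_of_nonneg_right he3 p4]
  have m4 : e * (a' ^ 2 * c' ^ 2) ≤ L ^ 2 * weight e b b' d d' := by
    calc e * (a' ^ 2 * c' ^ 2)
        ≤ e * ((L * (b' ^ 2 + e * b ^ 2)) * (L * (d' ^ 2 + e * d ^ 2))) := by gcongr
      _ = L ^ 2 * (e * (b' ^ 2 * d' ^ 2) + e ^ 2 * (b ^ 2 * d' ^ 2 + b' ^ 2 * d ^ 2)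
          + e ^ 3 * (b ^ 2 * d ^ 2)) := by ring
      _ ≤ L ^ 2 * weight e b b' d d' := by
        refine mul_le_mul_of_nonneg_left ?_ (sq_nonneg L)
        unfold weight
        linarith [mul_le_mul_of_nonneg_right e21 (add_nonneg p2 p3),
          mul_le_mul_of_nonneg_right he3 p1]
  calc weight e a a' c c' = a ^ 2 * c' ^ 2 + a' ^ 2 * c ^ 2 + e * (a ^ 2 * c ^ 2)
        + e * (a' ^ 2 * c' ^ 2) := by unfold weight; ring
    _ ≤ _ := by linarith

/-- Row–column products factor when summed. Row–row products are repeated once per column and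
column–column ones once per row; the factor `e` compensates this multiplicity. -/
theorem sum_weight_le {m n : Type*} [Fintype m] [Fintype n] {e ℓ : ℝ} (he : 0 ≤ e)
    (hn : e * Fintype.card n ≤ 1) (hm : e * Fintype.card m ≤ ℓ) (A C : m ⊕ n → ℝ) :
    ∑ k : m × n, weight e (A (.inl k.1)) (A (.inr k.2)) (C (.inl k.1)) (C (.inr k.2))
      ≤ (3 + ℓ) * ((∑ t, A t ^ 2) * ∑ t, C t ^ 2) := by
  have hℓ : 0 ≤ ℓ := le_trans (by positivity) hm
  set a := ∑ i, A (.inl i) ^ 2 with ha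
  set a' := ∑ j, A (.inr j) ^ 2 with ha'
  set c := ∑ i, C (.inl i) ^ 2 with hc
  set c' := ∑ j, C (.inr j) ^ 2 with hc'
  have a0 : 0 ≤ a := Finset.sum_nonneg fun _ _ => sq_nonneg _
  have a0' : 0 ≤ a' := Finset.sum_nonneg fun _ _ => sq_nonneg _
  have c0 : 0 ≤ c := Finset.sum_nonneg fun _ _ => sq_nonneg _
  have c0' : 0 ≤ c' := Finset.sum_nonneg fun _ _ => sq_nonneg _
  have d1 : ∑ i, A (.inl i) ^ 2 * C (.inl i) ^ 2 ≤ a * c := by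
    rw [hc, Finset.mul_sum]
    refine Finset.sum_le_sum fun i _ => mul_le_mul_of_nonneg_right ?_ (sq_nonneg _)
    exact Finset.single_le_sum (f := fun i => A (.inl i) ^ 2) (fun _ _ => sq_nonneg _)
      (Finset.mem_univ i)
  have d2 : ∑ j, A (.inr j) ^ 2 * C (.inr j) ^ 2 ≤ a' * c' := by
    rw [hc', Finset.mul_sum]
    refine Finset.sum_le_sum fun i _ => mul_le_mul_of_nonneg_right ?_ (sq_nonneg _)
    exact Finset.single_le_sum (f := fun i => A (.inr i) ^ 2) (fun _ _ => sq_nonneg _)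
      (Finset.mem_univ i)
  have hsum : ∑ k : m × n, weight e (A (.inl k.1)) (A (.inr k.2)) (C (.inl k.1)) (C (.inr k.2))
      = a * c' + a' * c + (e * Fintype.card n) * ∑ i, A (.inl i) ^ 2 * C (.inl i) ^ 2
        + (e * Fintype.card m) * ∑ j, A (.inr j) ^ 2 * C (.inr j) ^ 2 := by
    rw [Fintype.sum_prod_type]
    simp only [weight, mul_add, Finset.sum_add_distrib, Finset.sum_const, Finset.card_univ,
      nsmul_eq_mul, ← Finset.mul_sum, ← Finset.sum_mul]
    ring
  rw [hsum, Fintype.sum_sum_type, Fintype.sum_sum_type]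
  have s1 : 0 ≤ ∑ i, A (.inl i) ^ 2 * C (.inl i) ^ 2 := Finset.sum_nonneg fun _ _ => by positivity
  have s2 : 0 ≤ ∑ j, A (.inr j) ^ 2 * C (.inr j) ^ 2 := Finset.sum_nonneg fun _ _ => by positivity
  have b1 : (e * Fintype.card n) * ∑ i, A (.inl i) ^ 2 * C (.inl i) ^ 2 ≤ 1 * (a * c) := by
    gcongr
  have b2 : (e * Fintype.card m) * ∑ j, A (.inr j) ^ 2 * C (.inr j) ^ 2 ≤ ℓ * (a' * c') := by
    gcongr
  have q1 := mul_nonneg a0 c0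
  have q2 := mul_nonneg a0 c0'
  have q3 := mul_nonneg a0' c0
  have q4 := mul_nonneg a0' c0'
  nlinarith [mul_nonneg hℓ q1, mul_nonneg hℓ q2, mul_nonneg hℓ q3]

end Weight

/-! ### Coordinatewise control of bilinear forms of the resolvent. -/

section ResolventControl

variable {m n : Type*} [Fintype m] [Fintype n] [DecidableEq m] [DecidableEq n]

/-- The matrix with entries `A i j + c i j * x (i, j)`. -/
def affineMat {m n : Type*} (A : Matrix m n ℂ) (c : m → n → ℂ) (x : m × n → ℂ) : Matrix m n ℂ :=
  Matrix.of fun i j => A i j + c i j * x (i, j)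

/-- The inverse of the linearization at the matrix `affineMat A c x`. -/
noncomputable def linInv (z : ℂ) (A : Matrix m n ℂ) (c : m → n → ℂ) (x : m × n → ℂ) :
    Matrix (m ⊕ n) (m ⊕ n) ℂ :=
  (linMat z (affineMat A c x))⁻¹

/-- The weight of the entry `k` at the point `x`. -/
noncomputable def entryWeight (e : ℝ) (z : ℂ) (A : Matrix m n ℂ) (c : m → n → ℂ)
    (U V : m ⊕ n → ℂ) (k : m × n) (x : m × n → ℂ) : ℝ :=
  weight e ‖(U ᵥ* linInv z A c x) (.inl k.1)‖ ‖(U ᵥ* linInv z A c x) (.inr k.2)‖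
    ‖(linInv z A c x *ᵥ V) (.inl k.1)‖ ‖(linInv z A c x *ᵥ V) (.inr k.2)‖

theorem linMat_affineMat_update {m n : Type*} [DecidableEq m] [DecidableEq n] (z : ℂ)
    (A : Matrix m n ℂ) (c : m → n → ℂ) (k : m × n) (x : m × n → ℂ) :
    linMat z (affineMat A c x) = linMat z (affineMat A c (Function.update x k 0))
      + (single (.inl k.1) (.inr k.2) (c k.1 k.2 * x k)
        + single (.inr k.2) (.inl k.1) (star (c k.1 k.2 * x k))) := by
  have key : ∀ i j, affineMat A c x i j = affineMat A c (Function.update x k 0) i j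
      + if k.1 = i ∧ k.2 = j then c k.1 k.2 * x k else 0 := by
    intro i j
    obtain ⟨i', j'⟩ := k
    by_cases h : i' = i ∧ j' = j
    · obtain ⟨rfl, rfl⟩ := h
      simp [affineMat]
    · have h' : (i, j) ≠ (i', j') := fun e => h ⟨(Prod.mk.inj e).1.symm, (Prod.mk.inj e).2.symm⟩
      simp [affineMat, Function.update_of_ne h', h]
  ext r s
  rcases r with i | j <;> rcases s with i' | j'
  · simp [linMat]
  · simp [linMat, single_apply, key i j']
  · have h2 : (k.2 = j ∧ k.1 = i') ↔ (k.1 = i' ∧ k.2 = j) := and_comm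
    simp only [linMat, fromBlocks_apply₂₁, conjTranspose_apply, Matrix.add_apply, single_apply,
      key i' j, Sum.inr.injEq, Sum.inl.injEq, reduceCtorEq, false_and, if_false, zero_add, h2, star_add]
    split_ifs <;> simp
  · simp [linMat]

theorem measurable_linInv_apply (z : ℂ) (A : Matrix m n ℂ) (c : m → n → ℂ) (r s : m ⊕ n) :
    Measurable fun x => linInv z A c x r s := by
  have hS : Continuous fun x => affineMat A c x := by
    refine continuous_matrix fun i j => ?_
    simp only [affineMat, of_apply]
    fun_prop
  have hM : Continuous fun x => linMat z (affineMat A c x) :=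
    Continuous.matrix_fromBlocks continuous_const hS hS.matrix_conjTranspose continuous_const
  -- Inverse as adjugate over determinant: measurability does not need invertibility.
  simp only [linInv, inv_def, Matrix.smul_apply, Ring.inverse_eq_inv', smul_eq_mul]
  exact hM.matrix_det.measurable.inv.mul (hM.matrix_adjugate.matrix_elem r s).measurable

theorem measurable_vecMul_linInv (z : ℂ) (A : Matrix m n ℂ) (c : m → n → ℂ) (U : m ⊕ n → ℂ)
    (t : m ⊕ n) : Measurable fun x => (U ᵥ* linInv z A c x) t := by
  simp only [vecMul, dotProduct]
  exact Finset.measurable_fun_sum _ fun s _ => (measurable_linInv_apply z A c s t).const_mul _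

theorem measurable_linInv_mulVec (z : ℂ) (A : Matrix m n ℂ) (c : m → n → ℂ) (V : m ⊕ n → ℂ)
    (t : m ⊕ n) : Measurable fun x => (linInv z A c x *ᵥ V) t := by
  simp only [mulVec, dotProduct]
  exact Finset.measurable_fun_sum _ fun s _ => (measurable_linInv_apply z A c t s).mul_const _

theorem measurable_dotProduct_linInv (z : ℂ) (A : Matrix m n ℂ) (c : m → n → ℂ)
    (U V : m ⊕ n → ℂ) : Measurable fun x => U ⬝ᵥ (linInv z A c x *ᵥ V) := by
  simp only [dotProduct]
  exact Finset.measurable_fun_sum _ fun s _ => (measurable_linInv_mulVec z A c V s).const_mul _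

theorem measurable_entryWeight (e : ℝ) (z : ℂ) (A : Matrix m n ℂ) (c : m → n → ℂ)
    (U V : m ⊕ n → ℂ) (k : m × n) : Measurable (entryWeight e z A c U V k) := by
  have h1 := fun t => ((measurable_vecMul_linInv z A c U t).norm.pow_const 2)
  have h2 := fun t => ((measurable_linInv_mulVec z A c V t).norm.pow_const 2)
  exact (((h1 _).mul (h2 _)).add ((h1 _).mul (h2 _))).add
    ((((h1 _).mul (h2 _)).add ((h1 _).mul (h2 _))).const_mul e)

theorem norm_dotProduct_linInv_le {z : ℂ} (hz : z ∉ nonnegReals) (A : Matrix m n ℂ)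
    (c : m → n → ℂ) (U V : m ⊕ n → ℂ) (x : m × n → ℂ) :
    ‖U ⬝ᵥ (linInv z A c x *ᵥ V)‖
      ≤ ‖WithLp.toLp 2 (star U)‖ * (kap z * ‖WithLp.toLp 2 V‖) := by
  have h := norm_dotProduct_star_le (star U) (linInv z A c x *ᵥ V)
  rw [star_star] at h
  exact h.trans (mul_le_mul_of_nonneg_left (norm_inv_mulVec_le hz _ V) (norm_nonneg _))

/-- Bilinear forms of the resolvent are controlled entry by entry. -/
theorem localControl_linInv {z : ℂ} (hz : z ∉ nonnegReals) {ν : m × n → Measure ℂ} {p : ℕ}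
    {M e K ℓ : ℝ} (h_int : ∀ k, Integrable (fun y => (1 + ‖y‖) ^ (4 * p)) (ν k))
    (hmom : ∀ k, ∫ y, (1 + ‖y‖) ^ (4 * p) ∂(ν k) ≤ M)
    (hhalf : ∀ k, 1 / 2 ≤ (ν k).real {y | ‖y‖ ≤ 2}) (he : 0 ≤ e) (he1 : e ≤ 1) (hK : 0 ≤ K)
    (hn : e * Fintype.card n ≤ 1) (hm : e * Fintype.card m ≤ ℓ)
    (A : Matrix m n ℂ) (c : m → n → ℂ) (hc : ∀ i j, ‖c i j‖ ^ 2 ≤ K * e) (U V : m ⊕ n → ℂ) :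
    LocalControl ν p M (fun x => U ⬝ᵥ (linInv z A c x *ᵥ V))
      (fun k x => (4 * K + 8 * K ^ 2) * kap z ^ 2 * e * entryWeight e z A c U V k x)
      (fun k x => (4 * K + 8 * K ^ 2) * kap z ^ 2 * e
        * (4 * ((2 + 16 * K) * kap z ^ 2) ^ 2 * entryWeight e z A c U V k x))
      (‖WithLp.toLp 2 (star U)‖ * (kap z * ‖WithLp.toLp 2 V‖))
      ((4 * K + 8 * K ^ 2) * (4 * (2 + 16 * K) ^ 2) * (3 + ℓ) * kap z ^ 10 * e
        * (‖WithLp.toLp 2 U‖ ^ 2 * ‖WithLp.toLp 2 V‖ ^ 2)) := by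
  have hκ := one_le_kap z
  have hκ0 : 0 ≤ kap z := zero_le_one.trans hκ
  have hℓ : 0 ≤ ℓ := le_trans (by positivity) hm
  have hw0 : ∀ k x, 0 ≤ entryWeight e z A c U V k x := fun k x => weight_nonneg he _ _ _ _
  have hξ : ∀ (k : m × n) (y : ℂ), ‖c k.1 k.2 * y‖ ^ 2 ≤ K * e * ‖y‖ ^ 2 := fun k y => by
    rw [norm_mul, mul_pow]
    exact mul_le_mul_of_nonneg_right (hc _ _) (sq_nonneg _)
  have hl : ∀ x, linMat z (affineMat A c x) * linInv z A c x = 1 := fun x => linMat_mul_inv hz _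
  have hr : ∀ x, linInv z A c x * linMat z (affineMat A c x) = 1 := fun x => inv_mul_linMat hz _
  have hent : ∀ x r s, ‖linInv z A c x r s‖ ≤ kap z := fun x r s => norm_inv_apply_le hz _ r s
  -- the same relation, read from the point `x` to the point with the entry `k` set to zero
  have hback : ∀ (k : m × n) (x : m × n → ℂ),
      linMat z (affineMat A c (Function.update x k 0)) = linMat z (affineMat A c x)
        + (single (.inl k.1) (.inr k.2) (-(c k.1 k.2 * x k))
          + single (.inr k.2) (.inl k.1) (star (-(c k.1 k.2 * x k)))) := fun k x => by
    rw [linMat_affineMat_update z A c k x, star_neg, ← single_neg, ← single_neg]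
    abel
  refine ⟨h_int, hmom, hhalf, measurable_dotProduct_linInv z A c U V,
    norm_dotProduct_linInv_le hz A c U V, fun k =>
      ((measurable_entryWeight e z A c U V k).const_mul _).const_mul _, ?_, ?_, ?_, ?_, ?_⟩
  · intro k x
    have := hw0 k x
    positivity
  · intro x
    rw [← Finset.mul_sum, ← Finset.mul_sum]
    have h1 := sum_weight_le he hn hm (fun t => ‖(U ᵥ* linInv z A c x) t‖)
      (fun t => ‖(linInv z A c x *ᵥ V) t‖)
    have hA : ∑ t, ‖(U ᵥ* linInv z A c x) t‖ ^ 2 ≤ (kap z * ‖WithLp.toLp 2 U‖) ^ 2 := by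
      have h := pow_le_pow_left₀ (norm_nonneg _)
        (norm_vecMul_inv_le hz (affineMat A c x) U) 2
      rwa [EuclideanSpace.norm_sq_eq] at h
    have hC : ∑ t, ‖(linInv z A c x *ᵥ V) t‖ ^ 2 ≤ (kap z * ‖WithLp.toLp 2 V‖) ^ 2 := by
      have h := pow_le_pow_left₀ (norm_nonneg _)
        (norm_inv_mulVec_le hz (affineMat A c x) V) 2
      rwa [EuclideanSpace.norm_sq_eq] at h
    have h2 : ∑ k, entryWeight e z A c U V k x ≤ (3 + ℓ) *
        ((kap z * ‖WithLp.toLp 2 U‖) ^ 2 * (kap z * ‖WithLp.toLp 2 V‖) ^ 2) := by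
      refine h1.trans ?_
      have : 0 ≤ ∑ t, ‖(linInv z A c x *ᵥ V) t‖ ^ 2 := Finset.sum_nonneg fun _ _ => sq_nonneg _
      gcongr
    -- The exponent 10 of `kap z` is 2 from the increment, 4 from the comparison of weights and 4
    -- from the norms of the two vectors.
    calc _ ≤ (4 * K + 8 * K ^ 2) * kap z ^ 2 * e * (4 * ((2 + 16 * K) * kap z ^ 2) ^ 2 *
          ((3 + ℓ) * ((kap z * ‖WithLp.toLp 2 U‖) ^ 2 * (kap z * ‖WithLp.toLp 2 V‖) ^ 2))) := by
          gcongr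
      _ = _ := by ring
  · intro k x
    have := hw0 k x
    positivity
  · intro k x hx
    refine mul_le_mul_of_nonneg_left ?_ (by positivity)
    have ht : ‖c k.1 k.2 * x k‖ ^ 2 ≤ 4 * K * e := by
      have h4 : ‖x k‖ ^ 2 ≤ 4 := by
        calc ‖x k‖ ^ 2 ≤ 2 ^ 2 := by gcongr
          _ = 4 := by norm_num
      have : K * e * ‖x k‖ ^ 2 ≤ K * e * 4 := by gcongr
      linarith [hξ k (x k)]
    -- Both vectors at the zeroed point are bounded by those at `x`. Since the identity treats left
    -- and right differently, the two bounds read the perturbation in opposite directions.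
    have hA := fun t => norm_vecMul_inv_apply_le (hl (Function.update x k 0)) (hr x)
      (linMat_affineMat_update z A c k x) (hent _) U t
    have hC := fun t => norm_inv_mulVec_apply_le (hl x) (hr (Function.update x k 0))
      (hback k x) (hent _) V t
    simp only [norm_neg] at hC
    refine weight_le_weight he he1 (by positivity) ?_ ?_ ?_ ?_
    · exact sq_le_of_le_add he he1 hK hκ (norm_nonneg _) ht (hA _)
    · refine sq_le_of_le_add he he1 hK hκ (norm_nonneg _) ht ?_
      rw [add_comm ‖(U ᵥ* linInv z A c x) (.inr k.2)‖ ‖(U ᵥ* linInv z A c x) (.inl k.1)‖]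
      exact hA _
    · exact sq_le_of_le_add he he1 hK hκ (norm_nonneg _) ht (hC _)
    · refine sq_le_of_le_add he he1 hK hκ (norm_nonneg _) ht ?_
      rw [add_comm ‖(linInv z A c x *ᵥ V) (.inr k.2)‖ ‖(linInv z A c x *ᵥ V) (.inl k.1)‖]
      exact hC _
  · intro k x
    have hC := fun t => norm_inv_mulVec_apply_le (hl (Function.update x k 0)) (hr x)
      (linMat_affineMat_update z A c k x) (hent _) V t
    have hD := dotProduct_inv_sub (hl x) (hr (Function.update x k 0)) (hback k x) U V
    refine sq_increment_le he he1 hK hκ (norm_nonneg (x k)) (norm_nonneg (c k.1 k.2 * x k))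
      (norm_nonneg _) (norm_nonneg _) (hξ k (x k)) (norm_nonneg _) (hC _) (hC _) ?_
    rw [hD, sub_sub_cancel]
    refine (norm_add_le _ _).trans (le_of_eq ?_)
    simp only [norm_mul, norm_neg, norm_star]
    ring

end ResolventControl

/-! ### Consequences of the moment assumptions on one entry. -/

section Laws

theorem one_add_pow_le {y : ℝ} (hy : 0 ≤ y) (p : ℕ) :
    (1 + y) ^ (4 * p) ≤ 2 ^ (4 * p) * (2 + y ^ (8 * p)) := by
  have h1 : y ^ (4 * p) ≤ 1 + y ^ (8 * p) := by
    have e : y ^ (8 * p) = (y ^ (4 * p)) ^ 2 := by rw [← pow_mul]; congr 1; ring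
    rw [e]
    nlinarith [sq_nonneg (y ^ (4 * p) - 1), sq_nonneg (y ^ (4 * p))]
  calc (1 + y) ^ (4 * p) ≤ 2 ^ (4 * p - 1) * (1 ^ (4 * p) + y ^ (4 * p)) :=
        add_pow_le zero_le_one hy _
    _ ≤ 2 ^ (4 * p) * (2 + y ^ (8 * p)) := by
        rw [one_pow]
        have h2 : (2 : ℝ) ^ (4 * p - 1) ≤ 2 ^ (4 * p) :=
          pow_le_pow_right₀ (by norm_num) (Nat.sub_le _ _)
        exact mul_le_mul h2 (by linarith) (by positivity) (by positivity)

variable {ρ : Measure ℂ} [IsProbabilityMeasure ρ]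

theorem integrable_one_add_norm_pow {p : ℕ} (h : Integrable (fun y => ‖y‖ ^ (8 * p)) ρ) :
    Integrable (fun y => (1 + ‖y‖) ^ (4 * p)) ρ := by
  refine Integrable.mono' (((integrable_const 2).add h).const_mul (2 ^ (4 * p)))
    (by fun_prop) (Eventually.of_forall fun y => ?_)
  rw [Real.norm_of_nonneg (by positivity)]
  exact one_add_pow_le (norm_nonneg y) p

theorem integral_one_add_norm_pow_le {p : ℕ} {M : ℝ}
    (h : Integrable (fun y => ‖y‖ ^ (8 * p)) ρ) (hM : ∫ y, ‖y‖ ^ (8 * p) ∂ρ ≤ M) :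
    ∫ y, (1 + ‖y‖) ^ (4 * p) ∂ρ ≤ 2 ^ (4 * p) * (2 + M) := by
  calc ∫ y, (1 + ‖y‖) ^ (4 * p) ∂ρ ≤ ∫ y, 2 ^ (4 * p) * (2 + ‖y‖ ^ (8 * p)) ∂ρ :=
        integral_mono (integrable_one_add_norm_pow h)
          (((integrable_const 2).add h).const_mul _) fun y => one_add_pow_le (norm_nonneg y) p
    _ = 2 ^ (4 * p) * (2 + ∫ y, ‖y‖ ^ (8 * p) ∂ρ) := by
        rw [integral_const_mul, integral_add (integrable_const 2) h]; simp
    _ ≤ _ := by gcongr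

/-- Markov for `‖y‖²` at level 4 leaves probability at most 1/4 outside the disc. -/
theorem half_le_real_norm_le_two (h : ∫ y, ‖y‖ ^ 2 ∂ρ = 1) :
    1 / 2 ≤ ρ.real {y | ‖y‖ ≤ 2} := by
  have hi : Integrable (fun y : ℂ => ‖y‖ ^ 2) ρ :=
    Integrable.of_integral_ne_zero (by rw [h]; exact one_ne_zero)
  have h1 := mul_meas_ge_le_integral_of_nonneg
    (Eventually.of_forall fun y : ℂ => sq_nonneg ‖y‖) hi 4
  have hmeas : MeasurableSet {y : ℂ | ‖y‖ ≤ 2} :=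
    measurableSet_le measurable_norm measurable_const
  have h2 := probReal_compl_eq_one_sub (μ := ρ) hmeas
  have h3 : ρ.real {y : ℂ | ‖y‖ ≤ 2}ᶜ ≤ ρ.real {y : ℂ | 4 ≤ ‖y‖ ^ 2} := by
    refine measureReal_mono fun y hy => ?_
    simp only [Set.mem_compl_iff, Set.mem_ofPred_eq, not_le] at hy ⊢
    nlinarith
  linarith

end Laws

/-! ### Translation of the model into the abstract setting. -/

section Model

theorem diag_le_specNorm {k : ℕ} {d : Fin k → ℝ} {b : ℝ} (h : specNorm (cdiag d) ≤ b)
    (i : Fin k) : d i ≤ b := by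
  rw [specNorm, cdiag, l2_opNorm_diagonal] at h
  have h1 := (norm_le_pi_norm (fun i => (d i : ℂ)) i).trans h
  rw [Complex.norm_real] at h1
  exact (Real.le_norm_self _).trans h1

variable {Ω : Type*} (S : Model Ω)

/-- The deterministic factor in front of the entry `X i j`. -/
noncomputable def Model.coef (n : ℕ) (i : Fin (S.N n)) (j : Fin n) : ℂ :=
  ((Real.sqrt n : ℝ) : ℂ)⁻¹ * (Real.sqrt (S.d n i) : ℂ) * (Real.sqrt (S.dt n j) : ℂ)

/-- The family of the entries of `X`. -/
def Model.entries (n : ℕ) (ω : Ω) (k : Fin (S.N n) × Fin n) : ℂ := S.X n ω k.1 k.2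

theorem Model.Sig_eq (n : ℕ) (ω : Ω) :
    S.Sig n ω = affineMat (S.A n) (S.coef n) (S.entries n ω) := by
  ext i j
  simp only [Model.Sig, affineMat, Model.coef, Model.entries, cdiag, Matrix.add_apply,
    Matrix.smul_apply, mul_diagonal, diagonal_mul, of_apply, smul_eq_mul]
  ring

theorem Model.dotProduct_Q {z : ℂ} (hz : z ∉ nonnegReals) (n : ℕ) (ω : Ω)
    (a b : Fin (S.N n) → ℂ) :
    a ⬝ᵥ (S.Q n z ω *ᵥ b)
      = Sum.elim a 0 ⬝ᵥ (linInv z (S.A n) (S.coef n) (S.entries n ω) *ᵥ Sum.elim b 0) := by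
  rw [linInv, dotProduct_inv_linMat hz, ← Model.Sig_eq, Model.Q]

theorem Model.norm_coef_sq_le {n : ℕ} {dm dtm : ℝ} (hn : 1 ≤ n)
    (hd : ∀ i, 0 ≤ S.d n i) (hdt : ∀ j, 0 ≤ S.dt n j) (hdm : ∀ i, S.d n i ≤ dm)
    (hdtm : ∀ j, S.dt n j ≤ dtm) (i : Fin (S.N n)) (j : Fin n) :
    ‖S.coef n i j‖ ^ 2 ≤ |dm * dtm| * (1 / (n : ℝ)) := by
  have hn0 : (0 : ℝ) < n := by exact_mod_cast hn
  have e : ‖S.coef n i j‖ ^ 2 = S.d n i * S.dt n j * (1 / (n : ℝ)) := by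
    simp only [Model.coef, norm_mul, norm_inv, Complex.norm_real, Real.norm_eq_abs, mul_pow,
      inv_pow, sq_abs]
    rw [Real.sq_sqrt hn0.le, Real.sq_sqrt (hd i), Real.sq_sqrt (hdt j)]
    ring
  rw [e]
  have h1 : S.d n i * S.dt n j ≤ dm * dtm :=
    mul_le_mul (hdm i) (hdtm j) (hdt j) ((hd i).trans (hdm i))
  have h2 := h1.trans (le_abs_self _)
  gcongr

theorem norm_toLp_elim_zero_sq {k l : ℕ} (a : Fin k → ℂ) :
    ‖WithLp.toLp 2 (Sum.elim a (0 : Fin l → ℂ))‖ ^ 2 = ‖WithLp.toLp 2 a‖ ^ 2 := by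
  rw [norm_toLp_sum_sq]; simp

variable [MeasurableSpace Ω] {μ : Measure Ω}

theorem Model.measurable_entries {n : ℕ} (hX : ∀ i j, Measurable fun ω => S.X n ω i j) :
    Measurable (S.entries n) :=
  measurable_pi_lambda _ fun k => hX k.1 k.2

theorem Model.integrable_Q [IsProbabilityMeasure μ] {z : ℂ} (hz : z ∉ nonnegReals) {n : ℕ}
    (hX : ∀ i j, Measurable fun ω => S.X n ω i j) (i j : Fin (S.N n)) :
    Integrable (fun ω => S.Q n z ω i j) μ := by
  have e : (fun ω => S.Q n z ω i j) = fun ω => Sum.elim (Pi.single i 1) 0 ⬝ᵥ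
      (linInv z (S.A n) (S.coef n) (S.entries n ω) *ᵥ Sum.elim (Pi.single j 1) 0) := by
    ext ω
    rw [← S.dotProduct_Q hz]
    simp
  rw [e]
  exact integrable_of_bound ((measurable_dotProduct_linInv z _ _ _ _).comp
    (S.measurable_entries hX)) _ fun ω => norm_dotProduct_linInv_le hz _ _ _ _ _

theorem Model.form_EQ {z : ℂ} {n : ℕ} (hQ : ∀ i j, Integrable (fun ω => S.Q n z ω i j) μ)
    (u v : EuclideanSpace ℂ (Fin (S.N n))) :
    form u (S.EQ μ n z) v = ∫ ω, form u (S.Q n z ω) v ∂μ := by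
  simp only [form, dotProduct, mulVec, Model.EQ, of_apply]
  rw [integral_finsetSum _ fun i _ =>
    (integrable_finsetSum _ fun j _ => (hQ i j).mul_const _).const_mul _]
  refine Finset.sum_congr rfl fun i _ => ?_
  rw [integral_const_mul, integral_finsetSum _ fun j _ => (hQ i j).mul_const _]
  simp only [integral_mul_const]

theorem form_sub {k : ℕ} (u v : EuclideanSpace ℂ (Fin k)) (P Q : Matrix (Fin k) (Fin k) ℂ) :
    form u (P - Q) v = form u P v - form u Q v := by
  simp only [form, sub_mulVec, dotProduct_sub]

theorem eval_C_mul_one_add_X_pow (a x : ℝ) (k : ℕ) :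
    (Polynomial.C a * (1 + Polynomial.X) ^ k).eval x = a * (1 + x) ^ k := by
  simp

theorem coeff_C_mul_one_add_X_pow_nonneg {a : ℝ} (ha : 0 ≤ a) (k l : ℕ) :
    0 ≤ (Polynomial.C a * (1 + Polynomial.X) ^ k).coeff l := by
  rw [Polynomial.coeff_C_mul, Polynomial.coeff_one_add_X_pow]
  positivity

end Model

end BilinearResolvent

open BilinearResolvent in
/-- The polynomials depend only on `p` and on the bounds `c`. The estimate holds at every `n ≥ 1`
with `ℓ⁻ ≤ N / n ≤ ℓ⁺`. -/
theorem mainTheorem2 (p : ℕ) (hp : 1 ≤ p) (c : Bounds) :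
    ∃ Φ Ψ : Polynomial ℝ, (∀ k, 0 ≤ Φ.coeff k) ∧ (∀ k, 0 ≤ Ψ.coeff k) ∧
      ∀ (Ω : Type*) [MeasurableSpace Ω] (μ : Measure Ω) [IsProbabilityMeasure μ] (S : Model Ω),
        S.Setting μ p c →
        ∀ n : ℕ, 1 ≤ n → c.ellMinus ≤ (S.N n : ℝ) / (n : ℝ) → (S.N n : ℝ) / (n : ℝ) ≤ c.ellPlus →
        ∀ z : ℂ, z ∉ nonnegReals →
          (∀ i j, Integrable (fun ω => S.Q n z ω i j) μ) ∧
          ∀ u v : EuclideanSpace ℂ (Fin (S.N n)),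
            Integrable (fun ω => ‖form u (S.Q n z ω - S.EQ μ n z) v‖ ^ (2 * p)) μ ∧
            ∫ ω, ‖form u (S.Q n z ω - S.EQ μ n z) v‖ ^ (2 * p) ∂μ ≤
              1 / (n : ℝ) ^ p * Φ.eval ‖z‖ * Ψ.eval (1 / distNonneg z) *
                ‖u‖ ^ (2 * p) * ‖v‖ ^ (2 * p) := by
  -- Absolute values make the constants non-negative whatever the signs of the numbers in `c`.
  set M : ℝ := 2 ^ (4 * p) * (2 + |c.moment|) with hM
  obtain ⟨C, hC, hbound⟩ := exists_moment_bound p M (by positivity) p le_rfl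
  set K : ℝ := |c.dmax * c.dtmax| with hK
  set L : ℝ := (4 * K + 8 * K ^ 2) * (4 * (2 + 16 * K) ^ 2) * (3 + |c.ellPlus|) with hL
  have hK0 : 0 ≤ K := abs_nonneg _
  have hL0 : 0 ≤ L := by positivity
  -- The moment bound is `C τ^p` with `τ = L κ^10 ‖u‖² ‖v‖² / n`, where `κ = kap z`; the product
  -- form of `kap` separates `|z|` from `1/δ_z`.
  refine ⟨Polynomial.C (C * L ^ p * 3 ^ (10 * p)) * (1 + Polynomial.X) ^ (10 * p),
    Polynomial.C 1 * (1 + Polynomial.X) ^ (10 * p),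
    coeff_C_mul_one_add_X_pow_nonneg (by positivity) _,
    coeff_C_mul_one_add_X_pow_nonneg zero_le_one _, ?_⟩
  intro Ω _ μ _ S hS n hn _ hratio z hz
  have hX := hS.measurable_X n hn
  have hQ : ∀ i j, Integrable (fun ω => S.Q n z ω i j) μ := S.integrable_Q hz hX
  refine ⟨hQ, fun u v => ?_⟩
  have hn0 : (0 : ℝ) < n := by exact_mod_cast hn
  set U : Fin (S.N n) ⊕ Fin n → ℂ := Sum.elim (star (WithLp.ofLp u)) 0 with hU
  set V : Fin (S.N n) ⊕ Fin n → ℂ := Sum.elim (WithLp.ofLp v) 0 with hV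
  set f : (Fin (S.N n) × Fin n → ℂ) → ℂ :=
    fun x => U ⬝ᵥ (linInv z (S.A n) (S.coef n) x *ᵥ V) with hf
  set ν : Fin (S.N n) × Fin n → Measure ℂ := fun k => μ.map fun ω => S.X n ω k.1 k.2 with hν
  have hprob : ∀ k, IsProbabilityMeasure (ν k) := fun k =>
    Measure.isProbabilityMeasure_map (hX k.1 k.2).aemeasurable
  have hE := S.measurable_entries hX
  -- Independence turns the law of the entries into a product measure, the setting of the moment
  -- bound.
  have hlaw : μ.map (S.entries n) = Measure.pi ν :=
    (iIndepFun_iff_map_fun_eq_pi_map fun k : Fin (S.N n) × Fin n =>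
      (hX k.1 k.2).aemeasurable).1 (hS.indep_X n hn)
  have hpow : ∀ (k : Fin (S.N n) × Fin n) (q : ℕ), ∫ y, ‖y‖ ^ q ∂(ν k)
      = ∫ ω, ‖S.X n ω k.1 k.2‖ ^ q ∂μ := fun k q =>
    integral_map (hX k.1 k.2).aemeasurable (by fun_prop)
  have hpowi : ∀ k, Integrable (fun y => ‖y‖ ^ (8 * p)) (ν k) := fun k =>
    (integrable_map_measure (by fun_prop) (hX k.1 k.2).aemeasurable).2
      (hS.integrable_moment_X n hn k.1 k.2)
  have hctrl := localControl_linInv hz (ν := ν) (p := p) (M := M) (e := 1 / (n : ℝ)) (K := K)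
    (ℓ := |c.ellPlus|) (fun k => integrable_one_add_norm_pow (hpowi k))
    (fun k => integral_one_add_norm_pow_le (hpowi k)
      (by rw [hpow]; exact (hS.moment_X_le n hn _ _).trans (le_abs_self _)))
    (fun k => half_le_real_norm_le_two (by rw [hpow]; exact hS.variance_X n hn _ _))
    (by positivity) (by rw [div_le_one hn0]; exact_mod_cast hn) hK0
    (by simp [hn0.ne'])
    (by
      rw [Fintype.card_fin, one_div, ← div_eq_inv_mul]
      exact hratio.trans (le_abs_self _))
    (S.A n) (S.coef n)
    (S.norm_coef_sq_le hn (hS.d_nonneg n hn) (hS.dt_nonneg n hn)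
      (diag_le_specNorm (hS.D_le n hn)) (diag_le_specNorm (hS.Dt_le n hn))) U V
  have hform : ∀ ω, form u (S.Q n z ω) v = f (S.entries n ω) := fun ω => S.dotProduct_Q hz n ω _ _
  have hmean : form u (S.EQ μ n z) v = ∫ x, f x ∂(Measure.pi ν) := by
    rw [S.form_EQ hQ, ← hlaw, integral_map hE.aemeasurable
      hctrl.measurable_f.aestronglyMeasurable]
    simp only [hform]
    rfl
  have hdiff : ∀ ω, ‖form u (S.Q n z ω - S.EQ μ n z) v‖ ^ (2 * p)
      = ‖f (S.entries n ω) - ∫ x, f x ∂(Measure.pi ν)‖ ^ (2 * p) := fun ω => by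
    rw [form_sub, hform, hmean]
  have hi := hctrl.integrable_norm_pow (∫ x, f x ∂(Measure.pi ν)) (2 * p)
  simp only [hdiff]
  have hi' := hi
  rw [← hlaw] at hi'
  refine ⟨by
    have := (integrable_map_measure hi'.aestronglyMeasurable hE.aemeasurable).1 hi'
    rw [hlaw] at this
    exact this, ?_⟩
  have h_int : ∫ ω, ‖f (S.entries n ω) - ∫ x, f x ∂(Measure.pi ν)‖ ^ (2 * p) ∂μ
      = ∫ x, ‖f x - ∫ y, f y ∂(Measure.pi ν)‖ ^ (2 * p) ∂(Measure.pi ν) := by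
    have hm := hi.aestronglyMeasurable
    rw [← hlaw] at hm
    have := (integral_map hE.aemeasurable hm).symm
    rw [hlaw] at this
    exact this
  rw [h_int]
  refine (hbound _ ν f _ _ _ _ hctrl).trans (le_of_eq ?_)
  have hUn : ‖WithLp.toLp 2 U‖ ^ 2 = ‖u‖ ^ 2 := by
    rw [hU, norm_toLp_elim_zero_sq]
    simp [EuclideanSpace.norm_sq_eq]
  have hVn : ‖WithLp.toLp 2 V‖ ^ 2 = ‖v‖ ^ 2 := by
    rw [hV, norm_toLp_elim_zero_sq]
  rw [hUn, hVn, eval_C_mul_one_add_X_pow, eval_C_mul_one_add_X_pow, ← hL, kap]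
  simp only [mul_pow, ← pow_mul, one_div, inv_pow]
  ring
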